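/- Let $G$ be an abelian group, let $R=\bigoplus_{\gamma\in G}R_\gamma$ be a $G$-graded ring, and let $\hbar\in R$ be a homogeneous element of degree $\varepsilon\in G$ that is regular (neither a left nor a right zero divisor), normal ($\hbar R=R\hbar$) and non-invertible. Let $\bar R:=R/\hbar R$, and let $\hat R:=R[\hbar^{-1}]$ be the localization of $R$ at the Ore set $\{\hbar^i\}_{i\ge 0}$, both with their natural $G$-gradings: $\bar R_\gamma$ is the image of $R_\gamma$, and $\hat R_\gamma$ consists of the fractions $\hbar^{-n}a$ with $n\ge 0$ and $a\in R_{n\varepsilon+\gamma}$. For a $G$-graded ring $A$, let $\mathrm{Mod}^G A$ be the abelian category of $G$-graded left $A$-modules with degree-preserving $A$-linear maps, and let $\mathrm{gldim}(\mathrm{Mod}^G A)$ be its global dimension, that is, the supremum (possibly $\infty$) of the projective dimensions of its objects. Assume that $R$ is left $G$-noetherian, i.e. every homogeneous left ideal of $R$ is finitely generated, and that $\mathrm{gldim}(\mathrm{Mod}^G\bar R)<\infty$. Then $$\mathrm{gldim}(\mathrm{Mod}^G R)=\max\{\ \mathrm{gldim}(\mathrm{Mod}^G\bar R)+1,\ \mathrm{gldim}(\mathrm{Mod}^G\hat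 R)\ \}.$$ -/

import Mathlib

open CategoryTheory CategoryTheory.Limits

universe u v

/-- If the family `D` of additive subgroups admits projections and generates `M`, then `M` is its
internal direct sum. -/
theorem isInternal_of_proj {G : Type v} [DecidableEq G] {M : Type u} [AddCommGroup M]
    (D : G → AddSubgroup M) (p : G → M →+ M)
    (hp_same : ∀ i, ∀ x ∈ D i, p i x = x) (hp_ne : ∀ i j, i ≠ j → ∀ x ∈ D i, p j x = 0)
    (hgen : ∀ x, x ∈ ⨆ i, D i) : DirectSum.IsInternal D := by
  have key : ∀ (f : DirectSum G fun i => D i) (j : G),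
      p j (DirectSum.coeAddMonoidHom D f) = f j := by
    intro f j
    induction f using DirectSum.induction_on with
    | zero => simp
    | of i x =>
      rw [DirectSum.coeAddMonoidHom_of]
      by_cases h : i = j
      · subst h; rw [hp_same i _ x.2, DirectSum.of_eq_same]
      · rw [hp_ne i j h _ x.2, DirectSum.of_eq_of_ne _ _ _ (Ne.symm h)]; rfl
    | add x y hx hy => simp [hx, hy]
  constructor
  · intro f g hfg
    ext j
    rw [← key, ← key, hfg]
  · intro x
    have := hgen x
    induction this using AddSubgroup.iSup_induction' with
    | hp i x hx => exact ⟨DirectSum.of (fun i => D i) i ⟨x, hx⟩, DirectSum.coeAddMonoidHom_of _ _ _⟩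
    | h1 => exact ⟨0, map_zero _⟩
    | hadd x y _ _ hx hy =>
      obtain ⟨a, rfl⟩ := hx
      obtain ⟨b, rfl⟩ := hy
      exact ⟨a + b, map_add _ _ _⟩

/-- A `G`-graded left module over the `G`-graded ring `A = ⨁ γ, 𝒜 γ`. -/
structure GrMod {G : Type v} [AddCommGroup G] [DecidableEq G] {A : Type u} [Ring A]
    (𝒜 : G → AddSubgroup A) [GradedRing 𝒜] : Type (max (u + 1) v) where
  /-- the underlying module -/
  carrier : Type u
  [addCommGroup : AddCommGroup carrier]
  [module : Module A carrier]
  /-- the homogeneous components -/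
  deg : G → AddSubgroup carrier
  isInternal : DirectSum.IsInternal deg
  smul_mem : ∀ {i j : G} {a : A} {m : carrier}, a ∈ 𝒜 i → m ∈ deg j → a • m ∈ deg (i + j)

namespace GrMod

variable {G : Type v} [AddCommGroup G] [DecidableEq G] {A : Type u} [Ring A]
  {𝒜 : G → AddSubgroup A} [GradedRing 𝒜]

instance : CoeSort (GrMod 𝒜) (Type u) := ⟨GrMod.carrier⟩

attribute [instance] GrMod.addCommGroup GrMod.module

/-- Morphisms of graded modules: `A`-linear maps that preserve degrees. -/
@[ext]
structure Hom (M N : GrMod 𝒜) : Type u where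
  /-- the underlying linear map -/
  toLin : M →ₗ[A] N
  map_mem : ∀ (i : G) (m : M), m ∈ M.deg i → toLin m ∈ N.deg i

instance : Category (GrMod 𝒜) where
  Hom M N := Hom M N
  id M := ⟨LinearMap.id, fun _ _ h => h⟩
  comp f g := ⟨g.toLin ∘ₗ f.toLin, fun i m h => g.map_mem i _ (f.map_mem i m h)⟩

/-- The underlying linear map of a morphism of graded modules. -/
def lin {M N : GrMod 𝒜} (f : M ⟶ N) : M →ₗ[A] N := Hom.toLin f

theorem lin_mem {M N : GrMod 𝒜} (f : M ⟶ N) {i : G} {m : M} (h : m ∈ M.deg i) :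
    lin f m ∈ N.deg i := Hom.map_mem f i m h

/-- Build a morphism of graded modules from a degree-preserving linear map. -/
def mkHom {M N : GrMod 𝒜} (f : M →ₗ[A] N) (h : ∀ (i : G) (m : M), m ∈ M.deg i → f m ∈ N.deg i) :
    M ⟶ N := Hom.mk f h

@[simp] theorem lin_mkHom {M N : GrMod 𝒜} (f : M →ₗ[A] N)
    (h : ∀ (i : G) (m : M), m ∈ M.deg i → f m ∈ N.deg i) : lin (mkHom f h) = f := rfl

@[simp] theorem lin_comp {M N P : GrMod 𝒜} (f : M ⟶ N) (g : N ⟶ P) :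
    lin (f ≫ g) = lin g ∘ₗ lin f := rfl

@[simp] theorem lin_id (M : GrMod 𝒜) : lin (𝟙 M) = LinearMap.id := rfl

theorem hom_ext {M N : GrMod 𝒜} {f g : M ⟶ N} (h : ∀ m, lin f m = lin g m) : f = g :=
  Hom.ext (LinearMap.ext h)

instance (M N : GrMod 𝒜) : Zero (M ⟶ N) :=
  ⟨mkHom 0 fun i _ _ => (N.deg i).zero_mem⟩

instance (M N : GrMod 𝒜) : Add (M ⟶ N) :=
  ⟨fun f g => mkHom (lin f + lin g) fun i _ h => (N.deg i).add_mem (lin_mem f h) (lin_mem g h)⟩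

instance (M N : GrMod 𝒜) : Neg (M ⟶ N) :=
  ⟨fun f => mkHom (-lin f) fun i _ h => (N.deg i).neg_mem (lin_mem f h)⟩

instance (M N : GrMod 𝒜) : AddCommGroup (M ⟶ N) where
  add_assoc f g h := hom_ext fun m => add_assoc (lin f m) (lin g m) (lin h m)
  zero_add f := hom_ext fun m => zero_add (lin f m)
  add_zero f := hom_ext fun m => add_zero (lin f m)
  add_comm f g := hom_ext fun m => add_comm (lin f m) (lin g m)
  neg_add_cancel f := hom_ext fun m => neg_add_cancel (lin f m)
  nsmul := nsmulRec
  zsmul := zsmulRec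

@[simp] theorem lin_zero (M N : GrMod 𝒜) : lin (0 : M ⟶ N) = 0 := rfl

@[simp] theorem lin_add {M N : GrMod 𝒜} (f g : M ⟶ N) : lin (f + g) = lin f + lin g := rfl

instance : Preadditive (GrMod 𝒜) where
  add_comp _ _ _ f f' g := hom_ext fun m => by simp
  comp_add _ _ _ _ _ _ := hom_ext fun _ => rfl

/-- The projection of a graded module onto its component of degree `i`. -/
noncomputable def proj (M : GrMod 𝒜) (i : G) : M →+ M :=
  ((M.deg i).subtype.comp (DFinsupp.evalAddMonoidHom i)).comp
    (AddEquiv.ofBijective (DirectSum.coeAddMonoidHom M.deg) M.isInternal).symm.toAddMonoidHom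

theorem proj_mem (M : GrMod 𝒜) (i : G) (x : M) : M.proj i x ∈ M.deg i :=
  Subtype.property _

theorem ofBijective_symm_of_mem (M : GrMod 𝒜) {i : G} {x : M} (h : x ∈ M.deg i) :
    (AddEquiv.ofBijective (DirectSum.coeAddMonoidHom M.deg) M.isInternal).symm x =
      DirectSum.of (fun i => M.deg i) i ⟨x, h⟩ := by
  rw [AddEquiv.symm_apply_eq]
  exact (DirectSum.coeAddMonoidHom_of M.deg i ⟨x, h⟩).symm

theorem proj_same (M : GrMod 𝒜) {i : G} {x : M} (h : x ∈ M.deg i) : M.proj i x = x := by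
  change (((AddEquiv.ofBijective (DirectSum.coeAddMonoidHom M.deg) M.isInternal).symm x) i : M) = x
  rw [ofBijective_symm_of_mem M h, DirectSum.of_eq_same]

theorem proj_ne (M : GrMod 𝒜) {i j : G} (hij : i ≠ j) {x : M} (h : x ∈ M.deg i) :
    M.proj j x = 0 := by
  change (((AddEquiv.ofBijective (DirectSum.coeAddMonoidHom M.deg) M.isInternal).symm x) j : M) = 0
  rw [ofBijective_symm_of_mem M h, DirectSum.of_eq_of_ne _ _ _ hij.symm]; rfl

theorem mem_iSup (M : GrMod 𝒜) (x : M) : x ∈ ⨆ i, M.deg i := by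
  obtain ⟨f, rfl⟩ := M.isInternal.2 x
  induction f using DirectSum.induction_on with
  | zero => rw [map_zero]; exact zero_mem _
  | of i x =>
    rw [DirectSum.coeAddMonoidHom_of]
    exact AddSubgroup.mem_iSup_of_mem i x.2
  | add x y hx hy => rw [map_add]; exact add_mem hx hy

theorem induction (M : GrMod 𝒜) {P : M → Prop} (h0 : P 0) (hd : ∀ i, ∀ x ∈ M.deg i, P x)
    (ha : ∀ x y, P x → P y → P (x + y)) (x : M) : P x :=
  AddSubgroup.iSup_induction M.deg (C := P) (M.mem_iSup x) hd h0 ha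

theorem lin_proj {M N : GrMod 𝒜} (f : M ⟶ N) (i : G) (x : M) :
    lin f (M.proj i x) = N.proj i (lin f x) := by
  induction x using M.induction with
  | h0 => simp
  | hd j x hx =>
    by_cases h : j = i
    · subst h; rw [proj_same M hx, proj_same N (lin_mem f hx)]
    · rw [proj_ne M h hx, proj_ne N h (lin_mem f hx), map_zero]
  | ha x y hx hy => simp [hx, hy]

/-- Every element lies in an additive subgroup that contains all its homogeneous components. -/
theorem mem_of_proj_mem (M : GrMod 𝒜) (S : AddSubgroup M) (x : M) (h : ∀ i, M.proj i x ∈ S) :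
    x ∈ S := by
  set f := (AddEquiv.ofBijective (DirectSum.coeAddMonoidHom M.deg) M.isInternal).symm x with hf
  have hx : x = DirectSum.coeAddMonoidHom M.deg f :=
    ((AddEquiv.ofBijective (DirectSum.coeAddMonoidHom M.deg) M.isInternal).apply_symm_apply x).symm
  have hfi : ∀ i, (f i : M) ∈ S := h
  classical
  rw [hx, DirectSum.coeAddMonoidHom_eq_dfinsuppSum]
  exact sum_mem fun i _ => hfi i

/-- The zero graded module. -/
def zeroObj : GrMod 𝒜 where
  carrier := PUnit
  deg _ := ⊤
  isInternal := isInternal_of_proj _ (fun _ => 0) (fun _ _ _ => rfl) (fun _ _ _ _ _ => rfl)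
    (fun _ => zero_mem _)
  smul_mem _ _ := trivial

instance : HasZeroObject (GrMod 𝒜) :=
  ⟨⟨zeroObj, (IsZero.iff_id_eq_zero _).2 (hom_ext fun _ => rfl)⟩⟩

/-- The kernel of a morphism, graded by its intersections with the homogeneous components. -/
def kerObj {M N : GrMod 𝒜} (f : M ⟶ N) : GrMod 𝒜 where
  carrier := LinearMap.ker (lin f)
  deg i := (M.deg i).comap (LinearMap.ker (lin f)).subtype.toAddMonoidHom
  isInternal := by
    have hk : ∀ i (x : LinearMap.ker (lin f)), M.proj i x ∈ LinearMap.ker (lin f) := by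
      intro i x
      rw [LinearMap.mem_ker, lin_proj, LinearMap.mem_ker.1 x.2, map_zero]
    refine isInternal_of_proj _
      (fun i => ((M.proj i).comp (LinearMap.ker (lin f)).subtype.toAddMonoidHom).codRestrict
        (LinearMap.ker (lin f)) (hk i)) ?_ ?_ ?_
    · intro i x hx
      exact Subtype.ext (M.proj_same hx)
    · intro i j hij x hx
      exact Subtype.ext (M.proj_ne hij hx)
    · intro x
      set S := ⨆ i, (M.deg i).comap (LinearMap.ker (lin f)).subtype.toAddMonoidHom with hS
      have : (x : M) ∈ S.map (LinearMap.ker (lin f)).subtype.toAddMonoidHom := by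
        refine M.mem_of_proj_mem _ _ fun i => ?_
        refine ⟨⟨M.proj i x, hk i x⟩, ?_, rfl⟩
        exact AddSubgroup.mem_iSup_of_mem i (M.proj_mem i x)
      obtain ⟨y, hy, hyx⟩ := this
      have : y = x := Subtype.ext hyx
      exact this ▸ hy
  smul_mem ha hm := M.smul_mem ha hm

/-- The cokernel of a morphism, graded by the images of the homogeneous components. -/
def cokerObj {M N : GrMod 𝒜} (f : M ⟶ N) : GrMod 𝒜 where
  carrier := N ⧸ LinearMap.range (lin f)
  deg i := (N.deg i).map (LinearMap.range (lin f)).mkQ.toAddMonoidHom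
  isInternal := by
    have hk : ∀ i, (LinearMap.range (lin f)).toAddSubgroup ≤
        (((LinearMap.range (lin f)).mkQ.toAddMonoidHom).comp (N.proj i)).ker := by
      rintro i _ ⟨x, rfl⟩
      rw [AddMonoidHom.mem_ker]
      change (LinearMap.range (lin f)).mkQ (N.proj i (lin f x)) = 0
      rw [← lin_proj]
      exact (Submodule.Quotient.mk_eq_zero _).2 ⟨_, rfl⟩
    refine isInternal_of_proj _ (fun i => QuotientAddGroup.lift _ _ (hk i)) ?_ ?_ ?_
    · rintro i _ ⟨x, hx, rfl⟩
      change (LinearMap.range (lin f)).mkQ (N.proj i x) = _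
      rw [N.proj_same hx]; rfl
    · rintro i j hij _ ⟨x, hx, rfl⟩
      change (LinearMap.range (lin f)).mkQ (N.proj j x) = _
      rw [N.proj_ne hij hx, map_zero]
    · intro x
      obtain ⟨y, rfl⟩ := (LinearMap.range (lin f)).mkQ_surjective x
      have h := N.mem_iSup y
      have := AddSubgroup.mem_map_of_mem (LinearMap.range (lin f)).mkQ.toAddMonoidHom h
      rw [AddSubgroup.map_iSup] at this
      exact this
  smul_mem := by
    rintro i j a _ ha ⟨m, hm, rfl⟩
    exact ⟨a • m, N.smul_mem ha hm, rfl⟩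

/-- The direct sum of two graded modules. -/
def prodObj (M N : GrMod 𝒜) : GrMod 𝒜 where
  carrier := M × N
  deg i := (M.deg i).prod (N.deg i)
  isInternal := by
    refine isInternal_of_proj _ (fun i => (M.proj i).prodMap (N.proj i)) ?_ ?_ ?_
    · rintro i ⟨x, y⟩ ⟨hx, hy⟩
      exact Prod.ext (M.proj_same hx) (N.proj_same hy)
    · rintro i j hij ⟨x, y⟩ ⟨hx, hy⟩
      exact Prod.ext (M.proj_ne hij hx) (N.proj_ne hij hy)
    · rintro ⟨x, y⟩
      have hx : ((x, 0) : M × N) ∈ ⨆ i, (M.deg i).prod (N.deg i) := by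
        induction x using M.induction with
        | h0 => exact zero_mem _
        | hd i x hx => exact AddSubgroup.mem_iSup_of_mem i ⟨hx, zero_mem _⟩
        | ha x y hx hy => simpa using add_mem hx hy
      have hy : ((0, y) : M × N) ∈ ⨆ i, (M.deg i).prod (N.deg i) := by
        induction y using N.induction with
        | h0 => exact zero_mem _
        | hd i x hx => exact AddSubgroup.mem_iSup_of_mem i ⟨zero_mem _, hx⟩
        | ha x y hx hy => simpa using add_mem hx hy
      simpa using add_mem hx hy
  smul_mem ha hm := ⟨M.smul_mem ha hm.1, N.smul_mem ha hm.2⟩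

instance : HasBinaryBiproducts (GrMod 𝒜) where
  has_binary_biproduct M N := hasBinaryBiproduct_of_total
    { pt := prodObj M N
      fst := mkHom (LinearMap.fst A M N) fun _ _ h => h.1
      snd := mkHom (LinearMap.snd A M N) fun _ _ h => h.2
      inl := mkHom (LinearMap.inl A M N) fun _ _ h => ⟨h, zero_mem _⟩
      inr := mkHom (LinearMap.inr A M N) fun _ _ h => ⟨zero_mem _, h⟩
      inl_fst := hom_ext fun _ => rfl
      inl_snd := hom_ext fun _ => rfl
      inr_fst := hom_ext fun _ => rfl
      inr_snd := hom_ext fun _ => rfl }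
    (hom_ext fun m => Prod.ext (add_zero m.1) (zero_add m.2))

/-- The inclusion of the kernel. -/
def kerι {M N : GrMod 𝒜} (f : M ⟶ N) : kerObj f ⟶ M :=
  mkHom (LinearMap.ker (lin f)).subtype fun _ _ h => h

/-- The projection to the cokernel. -/
def cokerπ {M N : GrMod 𝒜} (f : M ⟶ N) : N ⟶ cokerObj f :=
  mkHom (LinearMap.range (lin f)).mkQ fun _ m h => ⟨m, h, rfl⟩

theorem kerι_comp {M N : GrMod 𝒜} (f : M ⟶ N) : kerι f ≫ f = 0 :=
  hom_ext fun m => LinearMap.mem_ker.1 m.2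

theorem comp_cokerπ {M N : GrMod 𝒜} (f : M ⟶ N) : f ≫ cokerπ f = 0 :=
  hom_ext fun m => (Submodule.Quotient.mk_eq_zero _).2 ⟨m, rfl⟩

theorem lin_apply_eq_zero {M N P : GrMod 𝒜} {f : M ⟶ N} {g : N ⟶ P} (h : f ≫ g = 0) (m : M) :
    lin g (lin f m) = 0 :=
  LinearMap.congr_fun (congrArg lin h) m

theorem injective_of_mono {M N : GrMod 𝒜} (f : M ⟶ N) [Mono f] : Function.Injective (lin f) := by
  rw [← LinearMap.ker_eq_bot, LinearMap.ker_eq_bot']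
  intro m hm
  have h : kerι f = 0 := by rw [← cancel_mono f, kerι_comp, zero_comp]
  exact LinearMap.congr_fun (congrArg lin h) (⟨m, hm⟩ : LinearMap.ker (lin f))

theorem surjective_of_epi {M N : GrMod 𝒜} (f : M ⟶ N) [Epi f] : Function.Surjective (lin f) := by
  intro n
  have h : cokerπ f = 0 := by rw [← cancel_epi f, comp_cokerπ, comp_zero]
  exact (Submodule.Quotient.mk_eq_zero _).1 (LinearMap.congr_fun (congrArg lin h) n)

/-- An injective morphism is a kernel of every morphism with which it forms an exact pair. -/
noncomputable def isLimitOfExact {M N P : GrMod 𝒜} (f : M ⟶ N) (g : N ⟶ P) (w : f ≫ g = 0)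
    (hf : Function.Injective (lin f)) (hg : ∀ n, lin g n = 0 → n ∈ LinearMap.range (lin f)) :
    IsLimit (KernelFork.ofι f w) :=
  have hfe (x : LinearMap.range (lin f)) :
      lin f ((LinearEquiv.ofInjective (lin f) hf).symm x) = x :=
    congrArg Subtype.val ((LinearEquiv.ofInjective (lin f) hf).apply_symm_apply x)
  KernelFork.IsLimit.ofι f w
    (fun {W} k hk => mkHom
      ((LinearEquiv.ofInjective (lin f) hf).symm.toLinearMap ∘ₗ
        (lin k).codRestrict (LinearMap.range (lin f)) fun m => hg _ (lin_apply_eq_zero hk m))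
      (by
        intro i m hm
        set x := ((LinearEquiv.ofInjective (lin f) hf).symm.toLinearMap ∘ₗ
          (lin k).codRestrict (LinearMap.range (lin f)) fun m => hg _ (lin_apply_eq_zero hk m)) m
          with hx
        have h1 : lin f x = lin k m := hfe _
        have h2 : M.proj i x = x := by
          apply hf
          rw [lin_proj, h1, N.proj_same (lin_mem k hm)]
        rw [← h2]
        exact M.proj_mem i x))
    (fun k hk => hom_ext fun m => hfe _)
    (fun k hk m hm => hom_ext fun x => hf (by
      refine Eq.trans ?_ (hfe _).symm
      exact LinearMap.congr_fun (congrArg lin hm) x))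

/-- A surjective morphism is a cokernel of every morphism with which it forms an exact pair. -/
noncomputable def isColimitOfExact {M N P : GrMod 𝒜} (f : M ⟶ N) (g : N ⟶ P) (w : f ≫ g = 0)
    (hg : Function.Surjective (lin g)) (hf : ∀ n, lin g n = 0 → n ∈ LinearMap.range (lin f)) :
    IsColimit (CokernelCofork.ofπ g w) :=
  have hs (x : P) : lin g (Function.surjInv hg x) = x := Function.surjInv_eq hg x
  have hk0 {W : GrMod 𝒜} (k : N ⟶ W) (hk : f ≫ k = 0) (n n' : N) (h : lin g n = lin g n') :
      lin k n = lin k n' := by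
    obtain ⟨m, hm⟩ := hf (n - n') (by rw [map_sub, h, sub_self])
    have := lin_apply_eq_zero hk m
    rw [hm, map_sub, sub_eq_zero] at this
    exact this
  CokernelCofork.IsColimit.ofπ g w
    (fun {W} k hk => mkHom
      { toFun := fun x => lin k (Function.surjInv hg x)
        map_add' := fun x y => by
          rw [← map_add]; apply hk0 k hk; rw [map_add, hs, hs, hs]
        map_smul' := fun a x => by
          rw [RingHom.id_apply, ← map_smul]; apply hk0 k hk; rw [map_smul, hs, hs] }
      (by
        intro i x hx
        change lin k (Function.surjInv hg x) ∈ _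
        rw [hk0 k hk _ (N.proj i (Function.surjInv hg x))
          (by rw [lin_proj, hs, P.proj_same hx])]
        exact lin_mem k (N.proj_mem _ _)))
    (fun k hk => hom_ext fun n => hk0 k hk _ _ (hs _))
    (fun k hk m hm => hom_ext fun x => by
      have := LinearMap.congr_fun (congrArg lin hm) (Function.surjInv hg x)
      change lin m (lin g _) = _ at this
      rw [hs] at this
      exact this)

instance : HasKernels (GrMod 𝒜) where
  has_limit f := ⟨⟨_, isLimitOfExact (kerι f) f (kerι_comp f) Subtype.val_injective
    fun n hn => ⟨(⟨n, hn⟩ : LinearMap.ker (lin f)), rfl⟩⟩⟩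

instance : HasCokernels (GrMod 𝒜) where
  has_colimit f := ⟨⟨_, isColimitOfExact f (cokerπ f) (comp_cokerπ f)
    (Submodule.mkQ_surjective _) fun _ hn => (Submodule.Quotient.mk_eq_zero _).1 hn⟩⟩

/-- The category of graded modules is abelian. -/
noncomputable instance : Abelian (GrMod 𝒜) where
  normalMonoOfMono f _ := ⟨
    { Z := cokerObj f
      g := cokerπ f
      w := comp_cokerπ f
      isLimit := isLimitOfExact f (cokerπ f) (comp_cokerπ f) (injective_of_mono f)
        fun _ hn => (Submodule.Quotient.mk_eq_zero _).1 hn }⟩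
  normalEpiOfEpi f _ := ⟨
    { W := kerObj f
      g := kerι f
      w := kerι_comp f
      isColimit := isColimitOfExact (kerι f) f (kerι_comp f) (surjective_of_epi f)
        fun n hn => ⟨(⟨n, hn⟩ : LinearMap.ker (lin f)), rfl⟩ }⟩
  has_finite_products := hasFiniteProducts_of_has_binary_and_terminal

end GrMod

/-- `A` is left `G`-noetherian: every homogeneous left ideal is finitely generated. -/
def IsLeftGNoetherian {G : Type v} [AddCommGroup G] [DecidableEq G] {A : Type u} [Ring A]
    (𝒜 : G → AddSubgroup A) [GradedRing 𝒜] : Prop :=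
  ∀ I : Ideal A, I.IsHomogeneous 𝒜 → I.FG

/-- The global dimension of an abelian category: the supremum of the projective dimensions of its
objects (the projective dimension of a zero object being `⊥`). -/
noncomputable def globalDimension (C : Type*) [Category C] [Abelian C] : WithBot ℕ∞ :=
  ⨆ X : C, projectiveDimension X

/-- `ħ` is a regular normal element of the graded ring `R`, homogeneous of degree `ε`. -/
structure IsRegularNormal {G : Type v} {R : Type u} [Ring R] (𝒜 : G → AddSubgroup R) (ε : G)
    (ħ : R) : Prop where
  mem : ħ ∈ 𝒜 ε
  regular : IsRegular ħ
  normal : Set.range (fun a : R => ħ * a) = Set.range (fun a : R => a * ħ)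

namespace IsRegularNormal

section Ring

variable {G : Type v} {R : Type u} [Ring R] {𝒜 : G → AddSubgroup R} {ε : G} {ħ : R}

theorem exists_left (h : IsRegularNormal 𝒜 ε ħ) (a : R) : ∃ b, b * ħ = ħ * a := by
  have : ħ * a ∈ Set.range (fun a : R => ħ * a) := ⟨a, rfl⟩
  rw [h.normal] at this
  exact this

/-- The quotient ring `R / ħR`; note that `ħR = Rħ` is a two-sided ideal. -/
def Bar (_h : IsRegularNormal 𝒜 ε ħ) : Type u := R ⧸ Ideal.span {ħ}

theorem isTwoSided (h : IsRegularNormal 𝒜 ε ħ) : (Ideal.span {ħ}).IsTwoSided := by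
  refine ⟨fun {a} b ha => ?_⟩
  obtain ⟨c, rfl⟩ := Ideal.mem_span_singleton'.1 ha
  obtain ⟨d, hd⟩ := h.exists_left b
  exact Ideal.mem_span_singleton'.2 ⟨c * d, by rw [mul_assoc, hd, mul_assoc]⟩

instance (h : IsRegularNormal 𝒜 ε ħ) : Ring h.Bar :=
  haveI := h.isTwoSided
  inferInstanceAs (Ring (R ⧸ Ideal.span {ħ}))

/-- The quotient map `R → R / ħR`. -/
def toBar (h : IsRegularNormal 𝒜 ε ħ) : R →+* h.Bar :=
  haveI := h.isTwoSided
  Ideal.Quotient.mk (Ideal.span {ħ})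

theorem toBar_surjective (h : IsRegularNormal 𝒜 ε ħ) : Function.Surjective h.toBar :=
  haveI := h.isTwoSided
  Ideal.Quotient.mk_surjective

theorem toBar_eq_zero (h : IsRegularNormal 𝒜 ε ħ) {a : R} :
    h.toBar a = 0 ↔ a ∈ Ideal.span {ħ} :=
  haveI := h.isTwoSided
  Ideal.Quotient.eq_zero_iff_mem

/-- The natural grading of `R / ħR`: the images of the homogeneous components of `R`. -/
def barDeg (h : IsRegularNormal 𝒜 ε ħ) (i : G) : AddSubgroup h.Bar :=
  (𝒜 i).map h.toBar.toAddMonoidHom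

theorem exists_left_pow (h : IsRegularNormal 𝒜 ε ħ) (n : ℕ) (a : R) :
    ∃ b, b * ħ ^ n = ħ ^ n * a := by
  induction n generalizing a with
  | zero => exact ⟨a, by simp⟩
  | succ n ih =>
    obtain ⟨b, hb⟩ := h.exists_left a
    obtain ⟨c, hc⟩ := ih b
    exact ⟨c, by rw [pow_succ, ← mul_assoc, hc, mul_assoc, hb, mul_assoc]⟩

/-- The powers of a regular normal element form a left Ore set. -/
@[reducible] noncomputable def oreSet (h : IsRegularNormal 𝒜 ε ħ) :
    OreLocalization.OreSet (Submonoid.powers ħ) where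
  ore_right_cancel r₁ r₂ s hs := by
    obtain ⟨_, n, rfl⟩ := s
    exact ⟨1, by rw [(h.regular.pow n).right hs]⟩
  oreNum r s := (h.exists_left_pow s.2.choose r).choose
  oreDenom _ s := s
  ore_eq r s := by
    have h2 : ħ ^ s.2.choose = s := s.2.choose_spec
    exact (congrArg (· * r) h2).symm.trans
      ((h.exists_left_pow s.2.choose r).choose_spec.symm.trans (congrArg (_ * ·) h2))

/-- The localization `R[ħ⁻¹]` of `R` at the Ore set of powers of `ħ`. -/
def Hat (h : IsRegularNormal 𝒜 ε ħ) : Type u :=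
  letI := h.oreSet
  OreLocalization (Submonoid.powers ħ) R

noncomputable instance (h : IsRegularNormal 𝒜 ε ħ) : Ring h.Hat :=
  letI := h.oreSet
  inferInstanceAs (Ring (OreLocalization (Submonoid.powers ħ) R))

/-- The fraction `ħ⁻ⁿ a`. -/
noncomputable def frac (h : IsRegularNormal 𝒜 ε ħ) (n : ℕ) (a : R) : h.Hat :=
  letI := h.oreSet
  OreLocalization.oreDiv a (⟨ħ ^ n, n, rfl⟩ : Submonoid.powers ħ)

theorem exists_frac (h : IsRegularNormal 𝒜 ε ħ) (x : h.Hat) : ∃ n a, x = h.frac n a := by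
  let := h.oreSet
  induction x using OreLocalization.ind with
  | _ a s =>
    obtain ⟨_, n, rfl⟩ := s
    exact ⟨n, a, rfl⟩

theorem frac_add (h : IsRegularNormal 𝒜 ε ħ) (n : ℕ) (a b : R) :
    h.frac n (a + b) = h.frac n a + h.frac n b := by
  let := h.oreSet
  exact OreLocalization.add_oreDiv.symm

theorem frac_expand (h : IsRegularNormal 𝒜 ε ħ) (m n : ℕ) (a : R) :
    h.frac n a = h.frac (m + n) (ħ ^ m * a) := by
  let := h.oreSet
  have := OreLocalization.expand a (⟨ħ ^ n, n, rfl⟩ : Submonoid.powers ħ) (ħ ^ m)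
    ⟨m + n, pow_add _ _ _⟩
  refine this.trans ?_
  change OreLocalization.oreDiv _ _ = OreLocalization.oreDiv _ _
  congr 1
  exact Subtype.ext (pow_add _ _ _).symm

theorem frac_zero (h : IsRegularNormal 𝒜 ε ħ) (n : ℕ) : h.frac n 0 = 0 := by
  let := h.oreSet
  exact OreLocalization.zero_oreDiv _

theorem frac_eq_zero (h : IsRegularNormal 𝒜 ε ħ) {n : ℕ} {a : R} (ha : h.frac n a = 0) :
    a = 0 := by
  let := h.oreSet
  rw [← h.frac_zero n] at ha
  obtain ⟨u, v, h1, h2⟩ := OreLocalization.oreDiv_eq_iff.1 ha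
  obtain ⟨_, m, rfl⟩ := u
  have h2' : ħ ^ m * ħ ^ n = v * ħ ^ n := h2
  have h1' : ħ ^ m * 0 = v * a := h1
  rw [← (h.regular.pow n).right h2', mul_zero] at h1'
  exact (h.regular.pow m).left (by simpa using h1'.symm)

theorem frac_mul_frac (h : IsRegularNormal 𝒜 ε ħ) {n m : ℕ} {a b c : R}
    (hc : c * ħ ^ m = ħ ^ m * a) : h.frac n a * h.frac m b = h.frac (m + n) (c * b) := by
  let := h.oreSet
  have := OreLocalization.oreDiv_mul_char a b (⟨ħ ^ n, n, rfl⟩ : Submonoid.powers ħ)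
    ⟨ħ ^ m, m, rfl⟩ c ⟨ħ ^ m, m, rfl⟩ hc.symm
  refine this.trans ?_
  change OreLocalization.oreDiv _ _ = OreLocalization.oreDiv _ _
  congr 1
  exact Subtype.ext (pow_add _ _ _).symm

theorem frac_one (h : IsRegularNormal 𝒜 ε ħ) : h.frac 0 1 = 1 := by
  let := h.oreSet
  refine Eq.trans ?_ (OreLocalization.one_def (S := Submonoid.powers ħ) (X := R)).symm
  change OreLocalization.oreDiv (1 : R) (⟨ħ ^ 0, 0, rfl⟩ : Submonoid.powers ħ) =
    OreLocalization.oreDiv (1 : R) (1 : Submonoid.powers ħ)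
  congr 1
  exact Subtype.ext (pow_zero _)

end Ring

variable {G : Type v} [AddCommGroup G] [DecidableEq G] {R : Type u} [Ring R]
  {𝒜 : G → AddSubgroup R} [GradedRing 𝒜] {ε : G} {ħ : R}

theorem iSup_deg_eq_top (a : R) : a ∈ ⨆ i, 𝒜 i := by
  induction a using DirectSum.Decomposition.inductionOn 𝒜 with
  | zero => exact zero_mem _
  | homogeneous m => exact AddSubgroup.mem_iSup_of_mem _ m.2
  | add m m' hm hm' => exact add_mem hm hm'

theorem barDeg_isInternal (h : IsRegularNormal 𝒜 ε ħ) : DirectSum.IsInternal h.barDeg := by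
  have hk : ∀ i, (Ideal.span {ħ}).toAddSubgroup ≤
      (h.toBar.toAddMonoidHom.comp (GradedRing.proj 𝒜 i)).ker := by
    intro i x hx
    have hI : (Ideal.span {ħ}).IsHomogeneous 𝒜 :=
      Ideal.homogeneous_span 𝒜 _ (by rintro x rfl; exact ⟨ε, h.mem⟩)
    exact h.toBar_eq_zero.2 (hI i hx)
  refine isInternal_of_proj _ (fun i => (QuotientAddGroup.lift _ _ (hk i) : h.Bar →+ h.Bar))
    ?_ ?_ ?_
  · rintro i _ ⟨a, ha, rfl⟩
    change h.toBar (GradedRing.proj 𝒜 i a) = h.toBar a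
    rw [GradedRing.proj_apply, DirectSum.decompose_of_mem_same 𝒜 ha]
  · rintro i j hij _ ⟨a, ha, rfl⟩
    change h.toBar (GradedRing.proj 𝒜 j a) = 0
    rw [GradedRing.proj_apply, DirectSum.decompose_of_mem_ne 𝒜 ha hij, map_zero]
  · intro x
    obtain ⟨a, rfl⟩ := h.toBar_surjective x
    have := AddSubgroup.mem_map_of_mem h.toBar.toAddMonoidHom (iSup_deg_eq_top (𝒜 := 𝒜) a)
    rw [AddSubgroup.map_iSup] at this
    exact this

noncomputable instance (h : IsRegularNormal 𝒜 ε ħ) : GradedRing h.barDeg where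
  one_mem := ⟨1, SetLike.one_mem_graded 𝒜, map_one h.toBar⟩
  mul_mem := by
    rintro i j _ _ ⟨a, ha, rfl⟩ ⟨b, hb, rfl⟩
    exact ⟨a * b, SetLike.mul_mem_graded ha hb, map_mul h.toBar a b⟩
  toDecomposition := h.barDeg_isInternal.chooseDecomposition

theorem pow_mul_mem (h : IsRegularNormal 𝒜 ε ħ) (n : ℕ) {i : G} {a : R} (ha : a ∈ 𝒜 i) :
    ħ ^ n * a ∈ 𝒜 (n • ε + i) :=
  SetLike.mul_mem_graded (SetLike.pow_mem_graded n h.mem) ha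

/-- The natural grading of `R[ħ⁻¹]`: the component of degree `i` consists of the fractions
`ħ⁻ⁿ a` with `a` homogeneous of degree `nε + i`. -/
def hatDeg (h : IsRegularNormal 𝒜 ε ħ) (i : G) : AddSubgroup h.Hat where
  carrier := {x | ∃ (n : ℕ) (a : R), a ∈ 𝒜 (n • ε + i) ∧ x = h.frac n a}
  zero_mem' := ⟨0, 0, zero_mem _, (h.frac_zero 0).symm⟩
  add_mem' := by
    rintro _ _ ⟨n, a, ha, rfl⟩ ⟨m, b, hb, rfl⟩
    refine ⟨m + n, ħ ^ m * a + ħ ^ n * b, add_mem ?_ ?_, ?_⟩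
    · rw [add_smul, add_assoc]; exact h.pow_mul_mem m ha
    · rw [add_comm m n, add_smul, add_assoc]; exact h.pow_mul_mem n hb
    · rw [h.frac_add, ← h.frac_expand, add_comm m n, ← h.frac_expand]
  neg_mem' := by
    rintro _ ⟨n, a, ha, rfl⟩
    refine ⟨n, -a, neg_mem ha, ?_⟩
    rw [eq_comm, eq_neg_iff_add_eq_zero, ← h.frac_add, neg_add_cancel, h.frac_zero]

theorem mem_of_mul_pow_eq (h : IsRegularNormal 𝒜 ε ħ) {n : ℕ} {i : G} {a c : R} (ha : a ∈ 𝒜 i)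
    (hc : c * ħ ^ n = ħ ^ n * a) : c ∈ 𝒜 i := by
  have hp : ħ ^ n ∈ 𝒜 (n • ε) := SetLike.pow_mem_graded n h.mem
  have key : ∀ j, j ≠ i → (DirectSum.decompose 𝒜 c j : R) = 0 := by
    intro j hj
    apply (h.regular.pow n).right
    change (DirectSum.decompose 𝒜 c j : R) * ħ ^ n = 0 * ħ ^ n
    rw [zero_mul, ← DirectSum.coe_decompose_mul_add_of_right_mem 𝒜 hp, hc]
    refine DirectSum.decompose_of_mem_ne 𝒜 (h.pow_mul_mem n ha) ?_
    rw [add_comm]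
    exact fun e => hj (add_right_cancel e).symm
  have : c = DirectSum.decompose 𝒜 c i := by
    apply (DirectSum.decompose 𝒜).injective
    rw [DirectSum.decompose_coe]
    ext j
    by_cases hj : j = i
    · subst hj; rw [DirectSum.of_eq_same]
    · rw [key j hj, DirectSum.of_eq_of_ne _ _ _ hj]; rfl
  rw [this]
  exact Subtype.property _

theorem hatDeg_mem_of_le (h : IsRegularNormal 𝒜 ε ħ) {i : G} {x : h.Hat} (hx : x ∈ h.hatDeg i) :
    ∃ N, ∀ n, N ≤ n → ∃ a ∈ 𝒜 (n • ε + i), x = h.frac n a := by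
  obtain ⟨N, a, ha, rfl⟩ := hx
  refine ⟨N, fun n hn => ?_⟩
  obtain ⟨m, rfl⟩ := Nat.exists_eq_add_of_le' hn
  exact ⟨ħ ^ m * a, by rw [add_smul, add_assoc]; exact h.pow_mul_mem m ha, h.frac_expand m N a⟩

theorem hatDeg_isInternal (h : IsRegularNormal 𝒜 ε ħ) : DirectSum.IsInternal h.hatDeg := by
  classical
  have hsum : ∀ (n : ℕ) (s : Finset G) (a : G → R),
      h.frac n (∑ i ∈ s, a i) = ∑ i ∈ s, h.frac n (a i) := fun n s a =>
    map_sum (AddMonoidHom.mk' (h.frac n) (h.frac_add n)) a s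
  constructor
  · rw [injective_iff_map_eq_zero]
    intro f hf
    choose N hN using fun i => h.hatDeg_mem_of_le (f i).2
    have hN' : ∀ i, ∃ a, i ∈ f.support →
        a ∈ 𝒜 ((∑ i ∈ f.support, N i) • ε + i) ∧
          (f i : h.Hat) = h.frac (∑ i ∈ f.support, N i) a := by
      intro i
      by_cases hi : i ∈ f.support
      · obtain ⟨a, ha⟩ := hN i _ (Finset.single_le_sum (f := N) (fun _ _ => Nat.zero_le _) hi)
        exact ⟨a, fun _ => ha⟩
      · exact ⟨0, fun hi' => absurd hi' hi⟩
    choose a ha using hN'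
    set n := ∑ i ∈ f.support, N i with hn
    rw [DirectSum.coeAddMonoidHom_eq_dfinsuppSum] at hf
    have h0 : ∑ i ∈ f.support, a i = 0 := by
      apply h.frac_eq_zero (n := n)
      rw [hsum]
      refine Eq.trans (Finset.sum_congr rfl fun i hi => (ha i hi).2.symm) hf
    ext j
    by_cases hj : j ∈ f.support
    · have h1 : a j = 0 := by
        have h2 := congrArg (fun x => (DirectSum.decompose 𝒜 x (n • ε + j) : R)) h0
        simp only [DirectSum.decompose_sum, DirectSum.decompose_zero] at h2
        rw [DFinsupp.finsetSum_apply, AddSubgroup.val_finsetSum, Finset.sum_eq_single j,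
          DirectSum.decompose_of_mem_same 𝒜 (ha j hj).1] at h2
        · exact h2
        · intro i hi hij
          exact DirectSum.decompose_of_mem_ne 𝒜 (ha i hi).1 fun e => hij (add_left_cancel e)
        · exact fun hj' => absurd hj hj'
      rw [(ha j hj).2, h1, h.frac_zero]; rfl
    · rw [DFinsupp.notMem_support_iff.1 hj]; rfl
  · intro x
    obtain ⟨n, a, rfl⟩ := h.exists_frac x
    induction a using DirectSum.Decomposition.inductionOn 𝒜 with
    | zero => exact ⟨0, by rw [map_zero, h.frac_zero]⟩
    | @homogeneous i m =>
      refine ⟨DirectSum.of (fun i => h.hatDeg i) (i - n • ε) ⟨h.frac n m, n, m, ?_, rfl⟩,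
        DirectSum.coeAddMonoidHom_of _ _ _⟩
      rw [add_sub_cancel]; exact m.2
    | add m m' hm hm' =>
      obtain ⟨f, hf⟩ := hm
      obtain ⟨g, hg⟩ := hm'
      exact ⟨f + g, by rw [map_add, hf, hg, h.frac_add]⟩

noncomputable instance (h : IsRegularNormal 𝒜 ε ħ) : GradedRing h.hatDeg where
  one_mem := ⟨0, 1, by rw [zero_smul, zero_add]; exact SetLike.one_mem_graded 𝒜, h.frac_one.symm⟩
  mul_mem := by
    rintro i j _ _ ⟨n, a, ha, rfl⟩ ⟨m, b, hb, rfl⟩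
    obtain ⟨c, hc⟩ := h.exists_left_pow m a
    refine ⟨m + n, c * b, ?_, h.frac_mul_frac hc⟩
    have := SetLike.mul_mem_graded (h.mem_of_mul_pow_eq ha hc) hb
    have e : (m + n) • ε + (i + j) = n • ε + i + (m • ε + j) := by rw [add_smul]; abel
    rw [e]; exact this
  toDecomposition := h.hatDeg_isInternal.chooseDecomposition

end IsRegularNormal

/-!
The projective dimension of a graded module agrees with that of its underlying module
(`GrMod.hasProjectiveDimensionLT_iff`), because a linear splitting of a graded cover can be replaced
by its degree-preserving part. All change-of-rings arguments can therefore be carried out for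
ungraded modules, and the gradings only matter for the class of modules over which one quantifies.
Let `d` be the global dimension of `Mod^G (R / ħR)`.

Lower bound. A graded `R[ħ⁻¹]`-module is its own localization, and localization sends projective
resolutions to projective resolutions, so `gldim R[ħ⁻¹] ≤ gldim R` (`modPDLT_hat`). Suppose that all
graded `R`-modules had projective dimension at most `d`. For a graded `R / ħR`-module `X` with free
presentation `F → X` over `R` and kernel `K`, multiplication by `ħ` on `F` induces an exact sequence
`0 → Y → K / ħK → Z → 0`, where `Y` is the twist of `X` by conjugation with `ħ` and `Z` is a first
syzygy of `X` over `R / ħR`. As `K` is torsion-free, `K / ħK` has projective dimension at most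
`d - 1`, and then so has `Y` (`modPDLT_twist`). Every graded `R / ħR`-module is such a twist, which
contradicts the choice of `d`. The case `d = 0` is separate: `R / ħR` is killed by `ħ`, so it is not
projective over `R`.

Upper bound. By a graded form of Auslander's theorem (`GrMod.modPDLT_of_cyclic`) it suffices to
bound the projective dimension of `R / I` for homogeneous left ideals `I`. Only targets `C` of `Ext`
that are ungraded are needed, so the dimension shift can use injective modules over `R` together with
a Baer criterion for homogeneous ideals. The ideal `I` is torsion-free and finitely generated, and so
are its syzygies in finite graded free resolutions; hence reduction modulo `ħ` and localization
commute with taking syzygies, and everything reduces to the following statement: a finitely generated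
torsion-free module `K` is projective if `K / ħK` and `K[ħ⁻¹]` are
(`IsLocalizationMap.projective_of_reduction`). To see this, let `F → K` be a free cover with kernel
`L`. Since `K / ħK` is projective, there is for each `n` a submodule `F'` of `F` that maps onto `K`
with kernel contained in `ħⁿL` (`exists_submodule_ker_eq_pow_smul`). A section `s` of
`F[ħ⁻¹] → K[ħ⁻¹]` satisfies `ħⁿ s(K) ⊆ F` for some `n`, as `K` is finitely generated. If `φ : F → F'`
lifts the projection, then `φ ∘ s` takes `K` into `F` and splits `F → K`.
-/

/-! ### Projective dimension of modules -/

section ModuleDimension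

variable {A : Type u} [Ring A]

/-- The `A`-module `M`, regarded as an object of the category of all (ungraded) `A`-modules, has
projective dimension `< n`. -/
abbrev ModPDLT (A : Type u) [Ring A] (M : Type u) [AddCommGroup M] [Module A M] (n : ℕ) : Prop :=
  HasProjectiveDimensionLT (ModuleCat.of A M) n

variable {M₁ M₂ M₃ : Type u} [AddCommGroup M₁] [AddCommGroup M₂] [AddCommGroup M₃]
  [Module A M₁] [Module A M₂] [Module A M₃]

/-- The short complex of modules given by an exact pair of linear maps. -/
abbrev shortComplexOfExact {f : M₁ →ₗ[A] M₂} {g : M₂ →ₗ[A] M₃} (hfg : Function.Exact f g) :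
    ShortComplex (ModuleCat.{u} A) :=
  ModuleCat.shortComplexOfCompEqZero f g hfg.linearMap_comp_eq_zero

theorem shortExact_shortComplexOfExact {f : M₁ →ₗ[A] M₂} {g : M₂ →ₗ[A] M₃}
    (hfg : Function.Exact f g) (hf : Function.Injective f) (hg : Function.Surjective g) :
    (shortComplexOfExact hfg).ShortExact :=
  ModuleCat.shortComplex_shortExact _ hfg hf hg

theorem modPDLT_one_iff {M : Type u} [AddCommGroup M] [Module A M] :
    ModPDLT A M 1 ↔ Module.Projective A M := by
  rw [IsProjective.iff_projective, projective_iff_hasProjectiveDimensionLT_one]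

theorem ModPDLT.mono {M : Type u} [AddCommGroup M] [Module A M] {m n : ℕ} (hmn : m ≤ n)
    (h : ModPDLT A M m) : ModPDLT A M n :=
  hasProjectiveDimensionLT_of_ge _ m n hmn

theorem ModPDLT.of_linearEquiv (e : M₁ ≃ₗ[A] M₂) {n : ℕ} (h : ModPDLT A M₁ n) :
    ModPDLT A M₂ n :=
  hasProjectiveDimensionLT_of_iso e.toModuleIso n

/-- Dimension shift along a presentation by a projective module. -/
theorem modPDLT_succ_iff_ker [Module.Projective A M₂] {g : M₂ →ₗ[A] M₃}
    (hg : Function.Surjective g) (n : ℕ) :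
    ModPDLT A M₃ (n + 2) ↔ ModPDLT A (LinearMap.ker g) (n + 1) :=
  (LinearMap.shortExact_shortComplexKer hg).hasProjectiveDimensionLT_X₃_iff n
    ((IsProjective.iff_projective M₂).1 inferInstance)

end ModuleDimension

/-! ### Graded modules and their underlying modules -/

namespace GrMod

variable {G : Type v} [AddCommGroup G] [DecidableEq G] {A : Type u} [Ring A]
  {𝒜 : G → AddSubgroup A} [GradedRing 𝒜]

theorem proj_smul (M : GrMod 𝒜) {i : G} (j : G) {a : A} (ha : a ∈ 𝒜 i) (x : M) :
    M.proj (i + j) (a • x) = a • M.proj j x := by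
  induction x using M.induction with
  | h0 => simp
  | hd k x hx =>
    by_cases h : k = j
    · subst h; rw [proj_same M hx, proj_same M (M.smul_mem ha hx)]
    · rw [proj_ne M h hx, smul_zero,
        proj_ne M (fun e => h (add_left_cancel e)) (M.smul_mem ha hx)]
  | ha x y hx hy => simp [hx, hy]

/-- The degree-preserving part of a linear map between graded modules, as an additive map. -/
noncomputable def degreePart {M N : GrMod 𝒜} (g : M →ₗ[A] N) : M →+ N :=
  (DirectSum.toAddMonoid fun i =>
      ((N.proj i).comp g.toAddMonoidHom).comp (M.deg i).subtype).comp
    (AddEquiv.ofBijective (DirectSum.coeAddMonoidHom M.deg) M.isInternal).symm.toAddMonoidHom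

theorem degreePart_of_mem {M N : GrMod 𝒜} (g : M →ₗ[A] N) {i : G} {x : M} (hx : x ∈ M.deg i) :
    degreePart g x = N.proj i (g x) := by
  change DirectSum.toAddMonoid _
    ((AddEquiv.ofBijective (DirectSum.coeAddMonoidHom M.deg) M.isInternal).symm x) = _
  rw [ofBijective_symm_of_mem M hx, DirectSum.toAddMonoid_of]
  rfl

/-- The degree-preserving part of a linear map between graded modules. -/
noncomputable def homPart {M N : GrMod 𝒜} (g : M →ₗ[A] N) : M ⟶ N :=
  mkHom
    { toFun := degreePart g
      map_add' := map_add _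
      map_smul' := fun a x => by
        rw [RingHom.id_apply]
        induction a using DirectSum.Decomposition.inductionOn 𝒜 with
        | zero => simp
        | @homogeneous i a =>
          induction x using M.induction with
          | h0 => simp
          | hd j x hx =>
            rw [degreePart_of_mem g hx, degreePart_of_mem g (M.smul_mem a.2 hx), map_smul,
              proj_smul N j a.2]
          | ha x y hx hy => rw [smul_add, map_add, hx, hy, map_add, smul_add]
        | add a b ha hb => rw [add_smul, map_add, ha, hb, add_smul] }
    fun i m hm => by
      change degreePart g m ∈ _
      rw [degreePart_of_mem g hm]
      exact N.proj_mem _ _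

theorem lin_homPart_of_mem {M N : GrMod 𝒜} (g : M →ₗ[A] N) {i : G} {x : M} (hx : x ∈ M.deg i) :
    lin (homPart g) x = N.proj i (g x) :=
  degreePart_of_mem g hx

theorem hom_ext_of_mem {M N : GrMod 𝒜} {f g : M ⟶ N}
    (h : ∀ i, ∀ m ∈ M.deg i, lin f m = lin g m) : f = g := by
  refine hom_ext fun m => ?_
  induction m using M.induction with
  | h0 => simp
  | hd i x hx => exact h i x hx
  | ha x y hx hy => rw [map_add, map_add, hx, hy]

theorem epi_of_surjective {M N : GrMod 𝒜} (f : M ⟶ N) (hf : Function.Surjective (lin f)) :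
    Epi f where
  left_cancellation _ _ hab := hom_ext fun n => by
    obtain ⟨m, rfl⟩ := hf n
    exact LinearMap.congr_fun (congrArg lin hab) m

theorem mono_of_injective {M N : GrMod 𝒜} (f : M ⟶ N) (hf : Function.Injective (lin f)) :
    Mono f where
  right_cancellation _ _ hab := hom_ext fun n => hf (LinearMap.congr_fun (congrArg lin hab) n)

/-- The graded free module with a basis element of degree `d i` for every `i : ι`. -/
noncomputable def freeObj (𝒜 : G → AddSubgroup A) [GradedRing 𝒜] (ι : Type u) (d : ι → G) :
    GrMod 𝒜 where
  carrier := ι →₀ A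
  deg γ :=
    { carrier := {f | ∀ i, f i ∈ 𝒜 (γ - d i)}
      zero_mem' := fun _ => zero_mem _
      add_mem' := fun ha hb i => add_mem (ha i) (hb i)
      neg_mem' := fun ha i => neg_mem (ha i) }
  isInternal := by
    let p : G → (ι →₀ A) →+ (ι →₀ A) := fun γ =>
      Finsupp.liftAddHom fun i =>
        (Finsupp.singleAddHom i).comp (GradedRing.proj 𝒜 (γ - d i))
    have hp : ∀ γ f i, p γ f i = (DirectSum.decompose 𝒜 (f i) (γ - d i) : A) := by
      intro γ f i
      induction f using Finsupp.induction_linear with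
      | zero => simp
      | add f g hf hg => simp [hf, hg]
      | single j a =>
        classical
        simp only [p, Finsupp.liftAddHom_apply_single, AddMonoidHom.comp_apply,
          Finsupp.singleAddHom_apply, GradedRing.proj_apply]
        by_cases h : j = i
        · subst h; simp
        · rw [Finsupp.single_eq_of_ne' h, Finsupp.single_eq_of_ne' h]; simp
    refine isInternal_of_proj _ p ?_ ?_ ?_
    · intro γ f hf
      ext i
      rw [hp, DirectSum.decompose_of_mem_same 𝒜 (hf i)]
    · intro γ γ' hne f hf
      ext i
      rw [hp, DirectSum.decompose_of_mem_ne 𝒜 (hf i) fun e => hne (sub_left_inj.1 e)]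
      rfl
    · intro f
      induction f using Finsupp.induction_linear with
      | zero => exact zero_mem _
      | add f g hf hg => exact add_mem hf hg
      | single j a =>
        induction a using DirectSum.Decomposition.inductionOn 𝒜 with
        | zero => rw [Finsupp.single_zero]; exact zero_mem _
        | add a b ha hb => rw [Finsupp.single_add]; exact add_mem ha hb
        | @homogeneous k a =>
          refine AddSubgroup.mem_iSup_of_mem (k + d j) fun i => ?_
          by_cases h : j = i
          · subst h; rw [Finsupp.single_eq_same, add_sub_cancel_right]; exact a.2
          · rw [Finsupp.single_eq_of_ne' h]; exact zero_mem _
  smul_mem := fun ha hm k => by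
    rw [add_sub_assoc]
    exact SetLike.mul_mem_graded ha (hm k)

instance (ι : Type u) (d : ι → G) : Module.Free A (freeObj 𝒜 ι d) :=
  inferInstanceAs (Module.Free A (ι →₀ A))

instance (ι : Type u) [Finite ι] (d : ι → G) : Module.Finite A (freeObj 𝒜 ι d) :=
  inferInstanceAs (Module.Finite A (ι →₀ A))

/-- The morphism out of a graded free module that is given on the basis by a family of homogeneous
elements. -/
noncomputable def freeHom {M : GrMod 𝒜} {ι : Type u} {d : ι → G} (w : ι → M)
    (hw : ∀ i, w i ∈ M.deg (d i)) : freeObj 𝒜 ι d ⟶ M :=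
  mkHom (M := freeObj 𝒜 ι d) (Finsupp.linearCombination A w) fun γ f hf => by
    change ∀ i, (show ι →₀ A from f) i ∈ 𝒜 (γ - d i) at hf
    change (show ι →₀ A from f).sum (fun i a => a • w i) ∈ M.deg γ
    refine AddSubgroup.sum_mem _ fun i _ => ?_
    have := M.smul_mem (hf i) (hw i)
    rwa [sub_add_cancel] at this

theorem range_freeHom {M : GrMod 𝒜} {ι : Type u} {d : ι → G} (w : ι → M)
    (hw : ∀ i, w i ∈ M.deg (d i)) :
    LinearMap.range (lin (freeHom w hw)) = Submodule.span A (Set.range w) :=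
  Finsupp.range_linearCombination A

theorem exists_free_cover (M : GrMod 𝒜) :
    ∃ (F : GrMod 𝒜) (p : F ⟶ M), Module.Free A F ∧ Function.Surjective (lin p) := by
  choose d hd using fun x : {m : M // ∃ i, m ∈ M.deg i} => x.2
  refine ⟨freeObj 𝒜 _ d, freeHom (fun x => x.1) hd, inferInstance, ?_⟩
  rw [← LinearMap.range_eq_top, range_freeHom, eq_top_iff]
  rintro x -
  induction x using M.induction with
  | h0 => exact zero_mem _
  | hd i x hx => exact Submodule.subset_span ⟨⟨x, i, hx⟩, rfl⟩
  | ha x y hx hy => exact add_mem hx hy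

/-- A graded module is projective in the graded category if and only if its underlying module is
projective: a linear splitting of a graded cover can be replaced by its degree-preserving part. -/
theorem projective_iff (M : GrMod 𝒜) : Projective M ↔ Module.Projective A M := by
  constructor
  · intro hM
    obtain ⟨F, p, hF, hp⟩ := exists_free_cover M
    have := epi_of_surjective p hp
    refine Module.Projective.of_split (lin (Projective.factorThru (𝟙 M) p)) (lin p) ?_
    rw [← lin_comp, Projective.factorThru_comp, lin_id]
  · intro hM
    refine ⟨fun {E X} f e _ => ?_⟩
    obtain ⟨g, hg⟩ := Module.projective_lifting_property (lin e) (lin f) (surjective_of_epi e)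
    refine ⟨homPart g, hom_ext_of_mem fun i m hm => ?_⟩
    rw [lin_comp, LinearMap.comp_apply, lin_homPart_of_mem g hm, lin_proj]
    rw [← LinearMap.comp_apply, hg, proj_same X (lin_mem f hm)]

/-- The kernel sequence of a surjective morphism of graded modules. -/
theorem shortExact_ker {M N : GrMod 𝒜} (p : M ⟶ N) (hp : Function.Surjective (lin p)) :
    (ShortComplex.mk (kerι p) p (kerι_comp p)).ShortExact where
  exact := ShortComplex.exact_of_f_is_kernel _
    (isLimitOfExact (kerι p) p (kerι_comp p) Subtype.val_injective
      fun n hn => ⟨(⟨n, hn⟩ : LinearMap.ker (lin p)), rfl⟩)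
  mono_f := mono_of_injective _ Subtype.val_injective
  epi_g := epi_of_surjective _ hp

/-- The projective dimension of a graded module agrees with that of its underlying module. -/
theorem hasProjectiveDimensionLT_iff (n : ℕ) (M : GrMod 𝒜) :
    HasProjectiveDimensionLT M (n + 1) ↔ ModPDLT A M (n + 1) := by
  induction n generalizing M with
  | zero =>
    rw [zero_add, ← projective_iff_hasProjectiveDimensionLT_one, modPDLT_one_iff, projective_iff]
  | succ n ih =>
    obtain ⟨F, p, hF, hp⟩ := exists_free_cover M
    rw [modPDLT_succ_iff_ker hp,
      (shortExact_ker p hp).hasProjectiveDimensionLT_X₃_iff n ((projective_iff F).2 inferInstance)]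
    exact ih (kerObj p)

theorem globalDimension_le_iff (n : ℕ) :
    globalDimension (GrMod 𝒜) ≤ n ↔ ∀ M : GrMod 𝒜, ModPDLT A M (n + 1) := by
  rw [globalDimension, iSup_le_iff]
  refine forall_congr' fun M => ?_
  rw [projectiveDimension_le_iff, ← hasProjectiveDimensionLT_iff]

/-- The ring itself as a graded module. -/
def selfObj (𝒜 : G → AddSubgroup A) [GradedRing 𝒜] : GrMod 𝒜 where
  carrier := A
  deg := 𝒜
  isInternal := DirectSum.Decomposition.isInternal 𝒜
  smul_mem ha hm := SetLike.mul_mem_graded ha hm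

theorem globalDimension_nonneg [Nontrivial A] : 0 ≤ globalDimension (GrMod 𝒜) := by
  refine le_trans ?_ (le_iSup _ (selfObj 𝒜))
  by_contra hlt
  rw [not_le, WithBot.lt_zero_iff_eq_bot, projectiveDimension_eq_bot_iff,
    IsZero.iff_id_eq_zero] at hlt
  exact one_ne_zero (α := A) (LinearMap.congr_fun (congrArg lin hlt) (1 : A))

end GrMod

namespace GrMod

variable {G : Type v} [AddCommGroup G] [DecidableEq G] {A : Type u} [Ring A]
  {𝒜 : G → AddSubgroup A} [GradedRing 𝒜]

/-! ### Homogeneous submodules and quotients -/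

/-- A submodule of a graded module is homogeneous if it contains the homogeneous components of its
elements. -/
def IsHomogeneousSubmodule {M : GrMod 𝒜} (N : Submodule A M) : Prop :=
  ∀ i, ∀ x ∈ N, M.proj i x ∈ N

theorem IsHomogeneousSubmodule.sup {M : GrMod 𝒜} {N N' : Submodule A M}
    (h : IsHomogeneousSubmodule N) (h' : IsHomogeneousSubmodule N') :
    IsHomogeneousSubmodule (N ⊔ N') := by
  intro i x hx
  obtain ⟨y, hy, z, hz, rfl⟩ := Submodule.mem_sup.1 hx
  rw [map_add]
  exact Submodule.add_mem_sup (h i y hy) (h' i z hz)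

theorem IsHomogeneousSubmodule.inf {M : GrMod 𝒜} {N N' : Submodule A M}
    (h : IsHomogeneousSubmodule N) (h' : IsHomogeneousSubmodule N') :
    IsHomogeneousSubmodule (N ⊓ N') :=
  fun i x hx => ⟨h i x hx.1, h' i x hx.2⟩

/-- The components of a multiple of a homogeneous element. -/
theorem proj_add_smul_of_mem (M : GrMod 𝒜) {j : G} {y : M} (hy : y ∈ M.deg j) (i : G) (a : A) :
    M.proj (i + j) (a • y) = (DirectSum.decompose 𝒜 a i : A) • y := by
  induction a using DirectSum.Decomposition.inductionOn 𝒜 with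
  | zero => simp
  | @homogeneous k a =>
    by_cases h : k = i
    · subst h
      rw [proj_same M (M.smul_mem a.2 hy), DirectSum.decompose_of_mem_same 𝒜 a.2]
    · rw [proj_ne M (fun e => h (add_right_cancel e)) (M.smul_mem a.2 hy),
        DirectSum.decompose_of_mem_ne 𝒜 a.2 h, zero_smul]
  | add a b ha hb =>
    rw [add_smul, map_add, ha, hb, DirectSum.decompose_add, DirectSum.add_apply,
      AddSubgroup.coe_add, add_smul]

theorem isHomogeneousSubmodule_span {M : GrMod 𝒜} {s : Set M}
    (hs : ∀ y ∈ s, ∃ i, y ∈ M.deg i) : IsHomogeneousSubmodule (Submodule.span A s) := by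
  intro i x hx
  induction hx using Submodule.closure_induction with
  | zero => rw [map_zero]; exact zero_mem _
  | add x y _ _ hx hy => rw [map_add]; exact add_mem hx hy
  | smul_mem a y hy =>
    obtain ⟨j, hj⟩ := hs y hy
    have := proj_add_smul_of_mem M hj (i - j) a
    rw [sub_add_cancel] at this
    rw [this]
    exact Submodule.smul_mem _ _ (Submodule.subset_span hy)

/-- The ideal of all scalars that move a homogeneous element into a homogeneous submodule. -/
theorem isHomogeneous_comap_toSpanSingleton {M : GrMod 𝒜} {N : Submodule A M}
    (hN : IsHomogeneousSubmodule N) {j : G} {y : M} (hy : y ∈ M.deg j) :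
    Ideal.IsHomogeneous 𝒜 (N.comap (LinearMap.toSpanSingleton A M y) : Ideal A) := by
  intro i a ha
  change (DirectSum.decompose 𝒜 a i : A) • y ∈ N
  rw [← proj_add_smul_of_mem M hy]
  exact hN _ _ ha

theorem selfObj_proj (i : G) (a : A) :
    (selfObj 𝒜).proj i a = (DirectSum.decompose 𝒜 a i : A) := by
  have h1 : (1 : A) ∈ (selfObj 𝒜).deg 0 := SetLike.one_mem_graded 𝒜
  have := proj_add_smul_of_mem (selfObj 𝒜) h1 i a
  rw [add_zero] at this
  exact ((congrArg ((selfObj 𝒜).proj i) (@mul_one A _ a)).symm.trans this).trans (@mul_one A _ _)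

/-- A homogeneous submodule as a graded module. -/
noncomputable def subObj (M : GrMod 𝒜) (N : Submodule A M) (hN : IsHomogeneousSubmodule N) :
    GrMod 𝒜 where
  carrier := N
  deg i := (M.deg i).comap N.subtype.toAddMonoidHom
  isInternal := by
    refine isInternal_of_proj _
      (fun i => ((M.proj i).comp N.subtype.toAddMonoidHom).codRestrict N
        fun x => hN i x x.2) ?_ ?_ ?_
    · intro i x hx
      exact Subtype.ext (M.proj_same hx)
    · intro i j hij x hx
      exact Subtype.ext (M.proj_ne hij hx)
    · intro x
      have : (x : M) ∈ (⨆ i, (M.deg i).comap N.subtype.toAddMonoidHom).map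
          N.subtype.toAddMonoidHom := by
        refine M.mem_of_proj_mem _ _ fun i => ⟨⟨M.proj i x, hN i x x.2⟩, ?_, rfl⟩
        exact AddSubgroup.mem_iSup_of_mem i (M.proj_mem i x)
      obtain ⟨y, hy, hyx⟩ := this
      have : y = x := Subtype.ext hyx
      exact this ▸ hy
  smul_mem ha hm := M.smul_mem ha hm

/-- The image of a graded module under an additive surjection `q` with homogeneous kernel, as a
graded module over a ring `B` whose homogeneous elements act on the image as homogeneous elements
of `A` of the same degree. -/
def imageObj {B : Type u} [Ring B] {ℬ : G → AddSubgroup B} [GradedRing ℬ] (M : GrMod 𝒜)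
    {N : Type u} [AddCommGroup N] [Module B N] (q : M →+ N) (hq : Function.Surjective q)
    (hker : ∀ i x, q x = 0 → q (M.proj i x) = 0)
    (hsmul : ∀ i, ∀ b ∈ ℬ i, ∃ a ∈ 𝒜 i, ∀ x, b • q x = q (a • x)) : GrMod ℬ where
  carrier := N
  deg i := (M.deg i).map q
  isInternal := by
    have hk : ∀ i, q.ker ≤ (q.comp (M.proj i)).ker := fun i x hx => hker i x hx
    refine isInternal_of_proj _
      (fun i => q.liftOfRightInverse _ (Function.rightInverse_surjInv hq)
        ⟨q.comp (M.proj i), hk i⟩) ?_ ?_ ?_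
    · rintro i _ ⟨x, hx, rfl⟩
      rw [AddMonoidHom.liftOfRightInverse_comp_apply, AddMonoidHom.comp_apply, M.proj_same hx]
    · rintro i j hij _ ⟨x, hx, rfl⟩
      rw [AddMonoidHom.liftOfRightInverse_comp_apply, AddMonoidHom.comp_apply, M.proj_ne hij hx,
        map_zero]
    · intro x
      obtain ⟨y, rfl⟩ := hq x
      have := AddSubgroup.mem_map_of_mem q (M.mem_iSup y)
      rwa [AddSubgroup.map_iSup] at this
  smul_mem := by
    rintro i j b _ hb ⟨x, hx, rfl⟩
    obtain ⟨a, ha, hab⟩ := hsmul i b hb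
    exact ⟨a • x, M.smul_mem ha hx, (hab x).symm⟩

/-- The cyclic graded module `A / I`. -/
def cyclicObj (I : Ideal A) (hI : I.IsHomogeneous 𝒜) : GrMod 𝒜 :=
  imageObj (selfObj 𝒜) (Submodule.mkQ I).toAddMonoidHom I.mkQ_surjective
    (fun i x hx => (Submodule.Quotient.mk_eq_zero I).2 <|
      (congrArg (fun z : A => z ∈ I) (selfObj_proj (𝒜 := 𝒜) i x)).mpr (hI i ((Submodule.Quotient.mk_eq_zero I).1 hx)))
    fun _ b hb => ⟨b, hb, fun _ => rfl⟩

/-! ### Reduction to cyclic modules -/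

/-- A Baer criterion: if linear maps into `C` extend from homogeneous left ideals to the whole
ring, they extend from homogeneous submodules to graded modules. The module `C` need not be
graded. -/
theorem exists_extension_of_homogeneous_baer {C : Type u} [AddCommGroup C] [Module A C]
    (hC : ∀ I : Ideal A, I.IsHomogeneous 𝒜 → ∀ g : I →ₗ[A] C,
      ∃ g' : A →ₗ[A] C, ∀ x : I, g' x = g x)
    (M : GrMod 𝒜) (N : Submodule A M) (hN : IsHomogeneousSubmodule N) (f : N →ₗ[A] C) :
    ∃ f' : M →ₗ[A] C, ∀ x : N, f' x = f x := by
  obtain ⟨m, hfm, hm, hmax⟩ := zorn_le_nonempty₀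
    {p : M →ₗ.[A] C | IsHomogeneousSubmodule p.domain} (fun c hc hchain p hp => by
      have hdir := hchain.directedOn
      refine ⟨LinearPMap.sSup c hdir, ?_, fun z hz => LinearPMap.le_sSup hdir hz⟩
      intro i x hx
      obtain ⟨z, hz, hxz⟩ := (LinearPMap.mem_domain_sSup_iff ⟨p, hp⟩ hdir).1 hx
      exact (LinearPMap.mem_domain_sSup_iff ⟨p, hp⟩ hdir).2 ⟨z, hz, hc hz i x hxz⟩)
    ⟨N, f⟩ hN
  have hm' : IsHomogeneousSubmodule m.domain := hm
  have htop : ∀ y, y ∈ m.domain := by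
    intro y
    induction y using M.induction with
    | h0 => exact zero_mem _
    | ha x y hx hy => exact add_mem hx hy
    | hd j y hy =>
      -- `m` extends to the submodule generated by its domain and `y`
      let g : (m.domain.comap (LinearMap.toSpanSingleton A M y) : Ideal A) →ₗ[A] C :=
        m.toFun ∘ₗ (LinearMap.toSpanSingleton A M y).restrict fun a ha => ha
      obtain ⟨g', hg'⟩ := hC _ (isHomogeneous_comap_toSpanSingleton hm' hy) g
      have hg'' : ∀ c (hc : c • y ∈ m.domain), c • g' 1 = m ⟨c • y, hc⟩ := fun c hc => by
        rw [← map_smul, smul_eq_mul, mul_one]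
        exact hg' ⟨c, hc⟩
      have hzero : ∀ c : A, c • y = 0 → c • g' 1 = 0 := fun c hc => by
        have hc' : c • y ∈ m.domain := by rw [hc]; exact zero_mem _
        rw [hg'' c hc', ← m.map_zero]
        congr 1
        exact Subtype.ext hc
      have hcompat : ∀ (x : m.domain)
          (z : (LinearPMap.mkSpanSingleton' (σ := RingHom.id A) y (g' 1) hzero).domain),
          (x : M) = z → m x = LinearPMap.mkSpanSingleton' (σ := RingHom.id A) y (g' 1) hzero z := by
        rintro ⟨x, hx⟩ ⟨z, hz⟩ (rfl : x = z)
        obtain ⟨c, rfl⟩ := Submodule.mem_span_singleton.1 hz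
        rw [LinearPMap.mkSpanSingleton'_apply]
        exact (hg'' c hx).symm
      have hle := hmax (y := m.sup _ hcompat)
        (hm'.sup (isHomogeneousSubmodule_span
          (by rintro z hz; rw [Set.mem_singleton_iff.1 hz]; exact ⟨j, hy⟩)))
        (LinearPMap.left_le_sup _ _ _)
      refine hle.1 ?_
      rw [LinearPMap.domain_sup]
      exact Submodule.mem_sup_right (Submodule.mem_span_singleton_self y)
  refine ⟨m.toFun ∘ₗ LinearMap.codRestrict m.domain LinearMap.id htop, fun x => ?_⟩
  exact (hfm.2 (x := x) (y := ⟨x, htop x⟩) rfl).symm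

/-- If `Ext¹(A / I, C)` vanishes, linear maps `I → C` extend to `A`. -/
theorem exists_extension_of_subsingleton_ext (I : Ideal A) (C : ModuleCat.{u} A)
    (h : Subsingleton (Abelian.Ext (ModuleCat.of A (A ⧸ I)) C 1)) (g : I →ₗ[A] C) :
    ∃ g' : A →ₗ[A] C, ∀ x : I, g' x = g x := by
  have hex : Function.Exact I.subtype I.mkQ := LinearMap.exact_subtype_mkQ I
  have hS := shortExact_shortComplexOfExact hex Subtype.val_injective I.mkQ_surjective
  obtain ⟨x, hx⟩ := Abelian.Ext.contravariant_sequence_exact₁ hS C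
    (Abelian.Ext.mk₀ (ModuleCat.ofHom g)) (add_zero 1) (Subsingleton.elim _ _)
  obtain ⟨φ, rfl⟩ := Abelian.Ext.homEquiv₀.symm.surjective x
  rw [Abelian.Ext.homEquiv₀_symm_apply, Abelian.Ext.mk₀_comp_mk₀] at hx
  have := Abelian.Ext.homEquiv₀.symm.injective hx
  exact ⟨φ.hom, fun x => LinearMap.congr_fun (congrArg ModuleCat.Hom.hom this) x⟩

/-- Vanishing of `Ext` into `C` passes from cyclic graded modules to all graded modules; the degree is
shifted down by embedding `C` into an injective (ungraded) module. -/
theorem subsingleton_ext_of_cyclic (n : ℕ) (C : ModuleCat.{u} A)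
    (hC : ∀ I : Ideal A, I.IsHomogeneous 𝒜 →
      Subsingleton (Abelian.Ext (ModuleCat.of A (A ⧸ I)) C (n + 1)))
    (M : GrMod 𝒜) : Subsingleton (Abelian.Ext (ModuleCat.of A M) C (n + 1)) := by
  induction n generalizing C with
  | zero =>
    obtain ⟨F, p, hF, hp⟩ := exists_free_cover M
    have hS := LinearMap.shortExact_shortComplexKer hp
    have hproj : Projective (ModuleCat.of A F) :=
      (IsProjective.iff_projective _).1 inferInstance
    refine ⟨fun x y => ?_⟩
    suffices ∀ x : Abelian.Ext (ModuleCat.of A M) C (0 + 1), x = 0 by rw [this x, this y]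
    intro x
    obtain ⟨z, rfl⟩ := Abelian.Ext.contravariant_sequence_exact₃ hS C x
      (Abelian.Ext.eq_zero_of_projective (P := ModuleCat.of A F) _) (add_comm 1 0)
    obtain ⟨φ, rfl⟩ := Abelian.Ext.homEquiv₀.symm.surjective z
    have hk : IsHomogeneousSubmodule (LinearMap.ker (lin p)) := fun i x hx => by
      rw [LinearMap.mem_ker, lin_proj, LinearMap.mem_ker.1 hx, map_zero]
    obtain ⟨f', hf'⟩ := exists_extension_of_homogeneous_baer
      (fun I hI => exists_extension_of_subsingleton_ext I C (hC I hI)) F _ hk φ.hom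
    have : φ = (lin p).shortComplexKer.f ≫ ModuleCat.ofHom f' := by
      ext x
      exact (hf' x).symm
    rw [this, Abelian.Ext.homEquiv₀_symm_apply, ← Abelian.Ext.mk₀_comp_mk₀,
      hS.extClass_comp_assoc]
  | succ n ih =>
    obtain ⟨pres⟩ := EnoughInjectives.presentation C
    have hS : (ShortComplex.mk _ _ (cokernel.condition pres.f)).ShortExact :=
      { exact := ShortComplex.exact_cokernel pres.f }
    have h1 := ih (cokernel pres.f) fun I hI => ⟨fun x y => by
      have := hC I hI
      have hxy : x - y = 0 := by
        obtain ⟨z, hz⟩ := Abelian.Ext.covariant_sequence_exact₃ (ModuleCat.of A (A ⧸ I)) hS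
          (x - y) rfl (Subsingleton.elim _ _)
        rw [← hz, Abelian.Ext.eq_zero_of_injective z, Abelian.Ext.zero_comp]
      exact sub_eq_zero.1 hxy⟩
    refine ⟨fun x y => ?_⟩
    suffices ∀ x : Abelian.Ext (ModuleCat.of A M) C (n + 1 + 1), x = 0 by rw [this x, this y]
    intro x
    obtain ⟨z, rfl⟩ := Abelian.Ext.covariant_sequence_exact₁ (ModuleCat.of A M) hS x
      (Abelian.Ext.eq_zero_of_injective _) rfl
    rw [Subsingleton.elim z 0, Abelian.Ext.zero_comp]

/-- Graded form of Auslander's theorem: the projective dimension of graded modules is bounded by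
that of the cyclic graded modules. -/
theorem modPDLT_of_cyclic (n : ℕ)
    (h : ∀ I : Ideal A, I.IsHomogeneous 𝒜 → ModPDLT A (A ⧸ I) (n + 1)) (M : GrMod 𝒜) :
    ModPDLT A M (n + 1) :=
  hasProjectiveDimensionLT_of_enoughInjectives _ _ fun C =>
    subsingleton_ext_of_cyclic n C (fun I hI =>
      have := h I hI
      HasProjectiveDimensionLT.subsingleton _ (n + 1) _ le_rfl C) M

/-! ### Graded noetherian rings -/

theorem fg_of_le_span (hA : IsLeftGNoetherian 𝒜) {M : GrMod 𝒜} (s : Finset M)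
    (hs : ∀ y ∈ s, ∃ i, y ∈ M.deg i) (N : Submodule A M) (hN : IsHomogeneousSubmodule N)
    (hle : N ≤ Submodule.span A s) : N.FG := by
  classical
  induction s using Finset.induction_on generalizing N with
  | empty =>
    rw [Finset.coe_empty, Submodule.span_empty, le_bot_iff] at hle
    rw [hle]
    exact Submodule.fg_bot
  | insert y s _ ih =>
    have hs' : IsHomogeneousSubmodule (Submodule.span A (s : Set M)) :=
      isHomogeneousSubmodule_span fun z hz => hs z (Finset.mem_insert_of_mem hz)
    obtain ⟨j, hj⟩ := hs y (Finset.mem_insert_self y s)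
    refine Submodule.fg_of_fg_map_of_fg_inf_ker (Submodule.span A (s : Set M)).mkQ ?_ ?_
    · -- modulo the span of `s`, the submodule `N` is an image of a homogeneous ideal
      have hI := hA _ (isHomogeneous_comap_toSpanSingleton (hN.sup hs') hj)
      have heq : N.map (Submodule.span A (s : Set M)).mkQ =
          Submodule.map ((Submodule.span A (s : Set M)).mkQ ∘ₗ LinearMap.toSpanSingleton A M y)
            ((N ⊔ Submodule.span A (s : Set M)).comap (LinearMap.toSpanSingleton A M y)) := by
        apply le_antisymm
        · rintro _ ⟨n, hn, rfl⟩
          have hn' := hle hn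
          rw [Finset.coe_insert, Submodule.mem_span_insert] at hn'
          obtain ⟨a, t, ht, rfl⟩ := hn'
          refine ⟨a, ?_, ?_⟩
          · refine Submodule.mem_sup.2 ⟨_, hn, -t, neg_mem ht, ?_⟩
            simp
          · have : (Submodule.span A (s : Set M)).mkQ t = 0 :=
              (Submodule.Quotient.mk_eq_zero _).2 ht
            rw [map_add, this, add_zero]
            rfl
        · rintro _ ⟨a, ha, rfl⟩
          obtain ⟨n, hn, t, ht, hnt⟩ := Submodule.mem_sup.1 ha
          refine ⟨n, hn, ?_⟩
          have : (Submodule.span A (s : Set M)).mkQ t = 0 :=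
            (Submodule.Quotient.mk_eq_zero _).2 ht
          rw [LinearMap.comp_apply, ← hnt, map_add, this, add_zero]
      exact heq ▸ Submodule.FG.map _ hI
    · rw [Submodule.ker_mkQ]
      exact ih (fun z hz => hs z (Finset.mem_insert_of_mem hz)) _ (hN.inf hs') inf_le_right

theorem exists_homogeneous_generators (M : GrMod 𝒜) [Module.Finite A M] :
    ∃ s : Finset M, (∀ y ∈ s, ∃ i, y ∈ M.deg i) ∧ Submodule.span A (s : Set M) = ⊤ := by
  have hspan : Submodule.span A {y : M | ∃ i, y ∈ M.deg i} = ⊤ := by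
    rw [eq_top_iff]
    rintro x -
    induction x using M.induction with
    | h0 => exact zero_mem _
    | hd i x hx => exact Submodule.subset_span ⟨i, hx⟩
    | ha x y hx hy => exact add_mem hx hy
  obtain ⟨s, hs, hs'⟩ := Submodule.fg_span_iff_fg_span_finset_subset _ |>.1
    (hspan ▸ Module.Finite.fg_top : (Submodule.span A {y : M | ∃ i, y ∈ M.deg i}).FG)
  exact ⟨s, fun y hy => hs hy, hs'.symm.trans hspan⟩

/-- Over a graded noetherian ring, a finitely generated graded module has a finitely generated
graded free cover with finitely generated kernel. -/
theorem exists_finite_free_cover (hA : IsLeftGNoetherian 𝒜) (M : GrMod 𝒜) [Module.Finite A M] :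
    ∃ (F : GrMod 𝒜) (p : F ⟶ M), Module.Free A F ∧ Module.Finite A F ∧
      Function.Surjective (lin p) ∧ Module.Finite A (kerObj p) := by
  classical
  obtain ⟨s, hs, hs'⟩ := exists_homogeneous_generators M
  choose d hd using fun x : s => hs x.1 x.2
  have hk (p : freeObj 𝒜 s d ⟶ M) : IsHomogeneousSubmodule (LinearMap.ker (lin p)) :=
    fun i x hx => by rw [LinearMap.mem_ker, lin_proj, LinearMap.mem_ker.1 hx, map_zero]
  refine ⟨freeObj 𝒜 s d, freeHom (fun x => x.1) hd, inferInstance, inferInstance, ?_, ?_⟩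
  · rw [← LinearMap.range_eq_top, range_freeHom, Subtype.range_coe_subtype]
    exact hs'
  · obtain ⟨t, ht, ht'⟩ := exists_homogeneous_generators (freeObj 𝒜 s d)
    exact Module.Finite.iff_fg.2 (fg_of_le_span hA t ht _ (hk _) (ht'.symm ▸ le_top))

end GrMod

/-! ### Semilinear maps along a ring homomorphism -/

section Semilinear

variable {R B : Type u} [Ring R] [Ring B] (φ : R →+* B)

/-- The coordinatewise map between free modules induced by a ring homomorphism. -/
noncomputable def finsuppMap (ι : Type u) : (ι →₀ R) →ₛₗ[φ] (ι →₀ B) where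
  toFun := Finsupp.mapRange φ (map_zero φ)
  map_add' _ _ := Finsupp.mapRange_add (map_add φ) _ _
  map_smul' a f := by ext i; simp

variable {φ}

@[simp] theorem finsuppMap_apply (ι : Type u) (f : ι →₀ R) (i : ι) :
    finsuppMap φ ι f i = φ (f i) := rfl

theorem finsuppMap_single (ι : Type u) (i : ι) (a : R) :
    finsuppMap φ ι (Finsupp.single i a) = Finsupp.single i (φ a) :=
  Finsupp.mapRange_single (hf := map_zero φ)

variable {M N F F' : Type u} [AddCommGroup M] [Module R M] [AddCommGroup N] [Module B N]
  [AddCommGroup F] [Module R F] [AddCommGroup F'] [Module B F']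

theorem linearCombination_finsuppMap (q : M →ₛₗ[φ] N) (f : M →₀ R) :
    Finsupp.linearCombination B q (finsuppMap φ M f) =
      q (Finsupp.linearCombination R id f) := by
  induction f using Finsupp.induction_linear with
  | zero => simp
  | add f g hf hg => simp [hf, hg]
  | single m a => rw [finsuppMap_single]; simp [LinearMap.map_smulₛₗ]

/-- The map induced on kernels by a commutative square. -/
def kerMap {p : F →ₗ[R] M} {p' : F' →ₗ[B] N} {qF : F →ₛₗ[φ] F'} {q : M →ₛₗ[φ] N}
    (w : ∀ f, p' (qF f) = q (p f)) : LinearMap.ker p →ₛₗ[φ] LinearMap.ker p' where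
  toFun f := ⟨qF f, by rw [LinearMap.mem_ker, w, f.2, map_zero]⟩
  map_add' _ _ := Subtype.ext (map_add qF _ _)
  map_smul' _ _ := Subtype.ext (LinearMap.map_smulₛₗ qF _ _)

@[simp] theorem coe_kerMap {p : F →ₗ[R] M} {p' : F' →ₗ[B] N} {qF : F →ₛₗ[φ] F'} {q : M →ₛₗ[φ] N}
    (w : ∀ f, p' (qF f) = q (p f)) (k : LinearMap.ker p) : (kerMap w k : F') = qF k := rfl

/-- A module obtained from a projective module by a universal base change is projective. -/
theorem projective_of_universal (q : M →ₛₗ[φ] N)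
    (hex : ∀ g : M →ₛₗ[φ] (M →₀ B), ∃ g' : N →ₗ[B] (M →₀ B), ∀ m, g' (q m) = g m)
    (huniq : ∀ g : N →ₗ[B] N, (∀ m, g (q m) = q m) → g = LinearMap.id)
    [Module.Projective R M] : Module.Projective B N := by
  obtain ⟨s, hs⟩ := Module.projective_lifting_property
    (Finsupp.linearCombination R (id : M → M)) LinearMap.id
    (Finsupp.linearCombination_id_surjective R M)
  obtain ⟨s', hs'⟩ := hex ((finsuppMap φ M).comp s)
  refine Module.Projective.of_split s' (Finsupp.linearCombination B q) (huniq _ fun m => ?_)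
  rw [LinearMap.comp_apply, hs', LinearMap.comp_apply, linearCombination_finsuppMap]
  exact congrArg q (LinearMap.congr_fun hs m)

end Semilinear

namespace IsRegularNormal

variable {G : Type v} {R : Type u} [Ring R] {𝒜 : G → AddSubgroup R} {ε : G} {ħ : R}

theorem exists_right (h : IsRegularNormal 𝒜 ε ħ) (b : R) : ∃ a, b * ħ = ħ * a := by
  have : b * ħ ∈ Set.range (fun a : R => a * ħ) := ⟨b, rfl⟩
  rw [← h.normal] at this
  obtain ⟨a, ha⟩ := this
  exact ⟨a, ha.symm⟩

section Modules

variable (h : IsRegularNormal 𝒜 ε ħ)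

/-- The `R`-module `M` has no `ħ`-torsion. -/
def TorsionFree (_h : IsRegularNormal 𝒜 ε ħ) (M : Type u) [AddCommGroup M] [Module R M] : Prop :=
  ∀ m : M, ħ • m = 0 → m = 0

variable {M N Z F F' : Type u} [AddCommGroup M] [Module R M] [AddCommGroup F] [Module R F]

theorem torsionFree_of_free [Module.Free R F] : h.TorsionFree F := by
  intro m hm
  apply (Module.Free.chooseBasis R F).repr.injective
  ext i
  have := DFunLike.congr_fun (congrArg (Module.Free.chooseBasis R F).repr hm) i
  rw [map_smul, map_zero] at this
  rw [map_zero]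
  exact h.regular.left (this.trans (mul_zero ħ).symm)

variable {h} in
theorem TorsionFree.of_injective (hF : h.TorsionFree F) (f : M →ₗ[R] F)
    (hf : Function.Injective f) : h.TorsionFree M := fun m hm =>
  hf (by rw [map_zero]; exact hF _ (by rw [← map_smul, hm, map_zero]))

/-! ### Reduction modulo `ħ` -/

theorem toBar_self : h.toBar ħ = 0 :=
  h.toBar_eq_zero.2 (Ideal.mem_span_singleton_self ħ)

/-- The semilinear map `q` exhibits the `R / ħR`-module `N` as `M / ħM`. -/
structure IsReduction [AddCommGroup N] [Module h.Bar N] (q : M →ₛₗ[h.toBar] N) : Prop where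
  surjective : Function.Surjective q
  eq_smul : ∀ m, q m = 0 → ∃ m', m = ħ • m'

theorem semilinear_bar_smul [AddCommGroup N] [Module h.Bar N] (q : M →ₛₗ[h.toBar] N) (m : M) :
    q (ħ • m) = 0 := by
  rw [LinearMap.map_smulₛₗ, toBar_self, zero_smul]

/-- The submodule `ħM` of `M`. -/
def smulSubmodule (h : IsRegularNormal 𝒜 ε ħ) (M : Type u) [AddCommGroup M] [Module R M] :
    Submodule R M where
  carrier := {m | ∃ m', m = ħ • m'}
  zero_mem' := ⟨0, (smul_zero _).symm⟩
  add_mem' := by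
    rintro _ _ ⟨a, rfl⟩ ⟨b, rfl⟩
    exact ⟨a + b, (smul_add _ _ _).symm⟩
  smul_mem' := by
    rintro b _ ⟨m, rfl⟩
    obtain ⟨a, ha⟩ := h.exists_right b
    exact ⟨a • m, by rw [← mul_smul, ha, mul_smul]⟩

/-- The quotient `M / ħM`. -/
def Red (h : IsRegularNormal 𝒜 ε ħ) (M : Type u) [AddCommGroup M] [Module R M] : Type u :=
  M ⧸ h.smulSubmodule M

instance : AddCommGroup (h.Red M) := inferInstanceAs (AddCommGroup (M ⧸ h.smulSubmodule M))

instance : Module h.Bar (h.Red M) :=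
  haveI := h.isTwoSided
  (Module.IsTorsionBy.module (R := R) (M := M ⧸ h.smulSubmodule M) (r := ħ) fun {x} => by
    obtain ⟨m, rfl⟩ := (h.smulSubmodule M).mkQ_surjective x
    exact (Submodule.Quotient.mk_eq_zero _).2 ⟨m, rfl⟩ : Module (R ⧸ Ideal.span {ħ}) _)

/-- The projection `M → M / ħM`. -/
def toRed (h : IsRegularNormal 𝒜 ε ħ) (M : Type u) [AddCommGroup M] [Module R M] :
    M →ₛₗ[h.toBar] h.Red M where
  toFun := (h.smulSubmodule M).mkQ
  map_add' := map_add _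
  map_smul' _ _ := rfl

theorem isReduction_toRed : h.IsReduction (h.toRed M) where
  surjective := (h.smulSubmodule M).mkQ_surjective
  eq_smul _ hm := (Submodule.Quotient.mk_eq_zero (h.smulSubmodule M)).1 hm

variable {h}

theorem IsReduction.exists_lift [AddCommGroup N] [Module h.Bar N] [AddCommGroup Z]
    [Module h.Bar Z] {q : M →ₛₗ[h.toBar] N} (hq : h.IsReduction q) (g : M →ₛₗ[h.toBar] Z) :
    ∃ g' : N →ₗ[h.Bar] Z, ∀ m, g' (q m) = g m := by
  have key : ∀ m m', q m = q m' → g m = g m' := fun m m' e => by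
    obtain ⟨x, hx⟩ := hq.eq_smul (m - m') (by rw [map_sub, e, sub_self])
    rw [← sub_eq_zero, ← map_sub, hx, h.semilinear_bar_smul]
  choose s hs using hq.surjective
  refine ⟨{ toFun := fun n => g (s n), map_add' := fun x y => ?_, map_smul' := fun b x => ?_ },
    fun m => key _ _ (hs _)⟩
  · rw [← map_add]
    exact key _ _ (by rw [map_add, hs, hs, hs])
  · obtain ⟨a, rfl⟩ := h.toBar_surjective b
    rw [RingHom.id_apply, ← LinearMap.map_smulₛₗ]
    exact key _ _ (by rw [LinearMap.map_smulₛₗ, hs, hs])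

theorem IsReduction.projective [AddCommGroup N] [Module h.Bar N] {q : M →ₛₗ[h.toBar] N}
    (hq : h.IsReduction q) [Module.Projective R M] : Module.Projective h.Bar N :=
  projective_of_universal q hq.exists_lift fun g hg => LinearMap.ext fun n => by
    obtain ⟨m, rfl⟩ := hq.surjective n
    exact hg m

/-- Reduction modulo `ħ` is exact on presentations of torsion-free modules. -/
theorem IsReduction.kerMap [AddCommGroup N] [Module h.Bar N] [AddCommGroup F'] [Module h.Bar F']
    {p : F →ₗ[R] M} {p' : F' →ₗ[h.Bar] N} {qF : F →ₛₗ[h.toBar] F'} {q : M →ₛₗ[h.toBar] N}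
    (w : ∀ f, p' (qF f) = q (p f)) (hqF : h.IsReduction qF) (hq : h.IsReduction q)
    (hp : Function.Surjective p) (hM : h.TorsionFree M) : h.IsReduction (kerMap w) where
  surjective := by
    rintro ⟨y, hy⟩
    obtain ⟨f, rfl⟩ := hqF.surjective y
    rw [LinearMap.mem_ker, w] at hy
    obtain ⟨m, hm⟩ := hq.eq_smul _ hy
    obtain ⟨g, rfl⟩ := hp m
    refine ⟨⟨f - ħ • g, by rw [LinearMap.mem_ker, map_sub, map_smul, hm, sub_self]⟩, ?_⟩
    apply Subtype.ext
    rw [coe_kerMap, map_sub, h.semilinear_bar_smul, sub_zero]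
  eq_smul := by
    rintro ⟨f, hf⟩ hk
    obtain ⟨g, rfl⟩ := hqF.eq_smul f (congrArg Subtype.val hk)
    rw [LinearMap.mem_ker, map_smul] at hf
    exact ⟨⟨g, hM _ hf⟩, rfl⟩

/-- If `M` is torsion-free, then `M / ħM` has projective dimension at most that of `M`. -/
theorem IsReduction.modPDLT (n : ℕ) {M N : Type u} [AddCommGroup M] [Module R M] [AddCommGroup N]
    [Module h.Bar N] {q : M →ₛₗ[h.toBar] N} (hq : h.IsReduction q) (hM : h.TorsionFree M)
    (hpd : ModPDLT R M (n + 1)) : ModPDLT h.Bar N (n + 1) := by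
  induction n generalizing M N with
  | zero =>
    have := modPDLT_one_iff.1 hpd
    exact modPDLT_one_iff.2 hq.projective
  | succ n ih =>
    have hp := Finsupp.linearCombination_id_surjective R M
    obtain ⟨p', w⟩ := (h.isReduction_toRed (M := M →₀ R)).exists_lift
      (q.comp (Finsupp.linearCombination R (id : M → M)))
    have hp' : Function.Surjective p' := fun y => by
      obtain ⟨m, rfl⟩ := hq.surjective y
      obtain ⟨f, rfl⟩ := hp m
      exact ⟨_, w f⟩
    have := (h.isReduction_toRed (M := M →₀ R)).projective
    rw [modPDLT_succ_iff_ker hp] at hpd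
    rw [modPDLT_succ_iff_ker hp']
    exact ih (IsReduction.kerMap w h.isReduction_toRed hq hp hM)
      (h.torsionFree_of_free.of_injective (LinearMap.ker _).subtype Subtype.val_injective) hpd

/-! ### Localization at `ħ` -/

variable (h)

/-- The canonical map `R → R[ħ⁻¹]`. -/
noncomputable def toHat : R →+* h.Hat where
  toFun := h.frac 0
  map_one' := h.frac_one
  map_zero' := h.frac_zero 0
  map_add' := h.frac_add 0
  map_mul' a b := (h.frac_mul_frac (n := 0) (m := 0) (by simp)).symm

theorem toHat_mul_frac (n : ℕ) (a : R) : h.toHat (ħ ^ n) * h.frac n a = h.toHat a :=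
  (h.frac_mul_frac (n := 0) (c := ħ ^ n) rfl).trans (h.frac_expand n 0 a).symm

theorem toHat_injective : Function.Injective h.toHat :=
  (injective_iff_map_eq_zero _).2 fun _ ha => h.frac_eq_zero ha

theorem isUnit_toHat_pow (n : ℕ) : IsUnit (h.toHat (ħ ^ n)) := by
  have h1 : h.frac n 1 * h.toHat (ħ ^ n) = 1 := by
    refine (h.frac_mul_frac (m := 0) (c := 1) (by simp)).trans ?_
    rw [← h.frac_one, h.frac_expand n 0 1, one_mul, mul_one, add_comm]
  exact ⟨⟨_, _, (h.toHat_mul_frac n 1).trans (map_one _), h1⟩, rfl⟩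

theorem pow_mul_pow_comm (m n : ℕ) : ħ ^ m * ħ ^ n = ħ ^ n * ħ ^ m :=
  (Commute.refl ħ).pow_pow m n

theorem smul_pow_injective [AddCommGroup N] [Module h.Hat N] (n : ℕ) {x y : N}
    (hxy : h.toHat (ħ ^ n) • x = h.toHat (ħ ^ n) • y) : x = y :=
  (h.isUnit_toHat_pow n).smul_left_cancel.1 hxy

/-- The semilinear map `j` exhibits the `R[ħ⁻¹]`-module `N` as the localization of the
torsion-free `R`-module `M`. -/
structure IsLocalizationMap [AddCommGroup N] [Module h.Hat N] (j : M →ₛₗ[h.toHat] N) : Prop where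
  injective : Function.Injective j
  exists_eq : ∀ y, ∃ (n : ℕ) (m : M), h.toHat (ħ ^ n) • y = j m

variable {h}

theorem IsLocalizationMap.torsionFree [AddCommGroup N] [Module h.Hat N] {j : M →ₛₗ[h.toHat] N}
    (hj : h.IsLocalizationMap j) : h.TorsionFree M := fun m hm => by
  apply hj.injective
  apply h.smul_pow_injective 1
  rw [← LinearMap.map_smulₛₗ, ← LinearMap.map_smulₛₗ, pow_one, hm, smul_zero]

/-- Denominators can be enlarged. -/
theorem smul_pow_add [AddCommGroup N] [Module h.Hat N] {j : M →ₛₗ[h.toHat] N} {y : N} {n : ℕ}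
    {m : M} (e : h.toHat (ħ ^ n) • y = j m) (k : ℕ) :
    h.toHat (ħ ^ (k + n)) • y = j (ħ ^ k • m) := by
  rw [pow_add, map_mul, mul_smul, e, LinearMap.map_smulₛₗ]

theorem IsLocalizationMap.hom_ext [AddCommGroup N] [Module h.Hat N] [AddCommGroup Z]
    [Module h.Hat Z] {j : M →ₛₗ[h.toHat] N} (hj : h.IsLocalizationMap j) {g g' : N →ₗ[h.Hat] Z}
    (hg : ∀ m, g (j m) = g' (j m)) : g = g' := LinearMap.ext fun y => by
  obtain ⟨n, m, e⟩ := hj.exists_eq y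
  apply h.smul_pow_injective n
  rw [← map_smul, ← map_smul, e, hg]

theorem IsLocalizationMap.exists_lift [AddCommGroup N] [Module h.Hat N] [AddCommGroup Z]
    [Module h.Hat Z] {j : M →ₛₗ[h.toHat] N} (hj : h.IsLocalizationMap j)
    (g : M →ₛₗ[h.toHat] Z) : ∃ g' : N →ₗ[h.Hat] Z, ∀ m, g' (j m) = g m := by
  have hex : ∀ y, ∃ z, ∀ n m, h.toHat (ħ ^ n) • y = j m → h.toHat (ħ ^ n) • z = g m := by
    intro y
    obtain ⟨n₀, m₀, e₀⟩ := hj.exists_eq y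
    obtain ⟨b, hb⟩ := (h.isUnit_toHat_pow n₀).exists_right_inv
    refine ⟨b • g m₀, fun n m e => ?_⟩
    have h1 : ħ ^ n • m₀ = ħ ^ n₀ • m := by
      apply hj.injective
      rw [← smul_pow_add e₀ n, ← smul_pow_add e n₀, add_comm]
    apply h.smul_pow_injective n₀
    rw [← mul_smul, ← map_mul, pow_mul_pow_comm, map_mul, mul_smul, ← mul_smul _ b, hb, one_smul,
      ← LinearMap.map_smulₛₗ, h1, LinearMap.map_smulₛₗ]
  choose s hs using hex
  have hadd : ∀ x y, s (x + y) = s x + s y := fun x y => by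
    obtain ⟨n, m, e⟩ := hj.exists_eq x
    obtain ⟨n', m', e'⟩ := hj.exists_eq y
    have e1 := smul_pow_add e n'
    have e2 := smul_pow_add e' n
    rw [add_comm] at e2
    apply h.smul_pow_injective (n' + n)
    rw [hs (x + y) _ (ħ ^ n' • m + ħ ^ n • m') (by rw [smul_add, e1, e2, map_add]), smul_add,
      hs _ _ _ e1, hs _ _ _ e2, map_add]
  have hsmul : ∀ (a : R) y, s (h.toHat a • y) = h.toHat a • s y := fun a y => by
    obtain ⟨n, m, e⟩ := hj.exists_eq y
    obtain ⟨b, hb⟩ := h.exists_left_pow n a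
    apply h.smul_pow_injective n
    rw [hs (h.toHat a • y) n (b • m), ← mul_smul, ← map_mul, ← hb, map_mul, mul_smul, hs _ _ _ e,
      LinearMap.map_smulₛₗ]
    rw [← mul_smul, ← map_mul, ← hb, map_mul, mul_smul, e, LinearMap.map_smulₛₗ]
  refine ⟨{ toFun := s, map_add' := hadd, map_smul' := fun x y => ?_ }, fun m => ?_⟩
  · obtain ⟨n, a, rfl⟩ := h.exists_frac x
    apply h.smul_pow_injective n
    rw [RingHom.id_apply, ← hsmul, ← mul_smul, ← mul_smul, toHat_mul_frac, hsmul]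
  · have := hs (j m) 0 m (by rw [pow_zero, map_one, one_smul])
    rwa [pow_zero, map_one, one_smul] at this

theorem IsLocalizationMap.projective [AddCommGroup N] [Module h.Hat N] {j : M →ₛₗ[h.toHat] N}
    (hj : h.IsLocalizationMap j) [Module.Projective R M] : Module.Projective h.Hat N :=
  projective_of_universal j hj.exists_lift fun _ hg => hj.hom_ext hg

theorem IsLocalizationMap.kerMap [AddCommGroup N] [Module h.Hat N] [AddCommGroup F']
    [Module h.Hat F'] {p : F →ₗ[R] M} {p' : F' →ₗ[h.Hat] N} {jF : F →ₛₗ[h.toHat] F'}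
    {j : M →ₛₗ[h.toHat] N} (w : ∀ f, p' (jF f) = j (p f)) (hjF : h.IsLocalizationMap jF)
    (hj : h.IsLocalizationMap j) : h.IsLocalizationMap (kerMap w) where
  injective _ _ e := Subtype.ext (hjF.injective (congrArg Subtype.val e))
  exists_eq := by
    rintro ⟨y, hy⟩
    obtain ⟨n, f, e⟩ := hjF.exists_eq y
    refine ⟨n, ⟨f, ?_⟩, Subtype.ext e⟩
    apply hj.injective
    rw [← w, ← e, map_smul, hy, smul_zero, map_zero]

theorem isLocalizationMap_finsuppMap (ι : Type u) :
    h.IsLocalizationMap (finsuppMap h.toHat ι) where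
  injective f g e := Finsupp.ext fun i => h.toHat_injective (DFunLike.congr_fun e i)
  exists_eq y := by
    induction y using Finsupp.induction_linear with
    | zero => exact ⟨0, 0, by rw [smul_zero, map_zero]⟩
    | add x y hx hy =>
      obtain ⟨n, m, e⟩ := hx
      obtain ⟨n', m', e'⟩ := hy
      have e2 := smul_pow_add e' n
      rw [add_comm] at e2
      exact ⟨n' + n, _, by rw [smul_add, smul_pow_add e n', e2, ← map_add]⟩
    | single i x =>
      obtain ⟨n, a, rfl⟩ := h.exists_frac x
      refine ⟨n, Finsupp.single i a, ?_⟩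
      rw [finsuppMap_single, Finsupp.smul_single, smul_eq_mul, toHat_mul_frac]

theorem IsLocalizationMap.surjective_of_comm [AddCommGroup N] [Module h.Hat N] [AddCommGroup F']
    [Module h.Hat F'] {p : F →ₗ[R] M} {p' : F' →ₗ[h.Hat] N} {jF : F →ₛₗ[h.toHat] F'}
    {j : M →ₛₗ[h.toHat] N} (w : ∀ f, p' (jF f) = j (p f)) (hj : h.IsLocalizationMap j)
    (hp : Function.Surjective p) : Function.Surjective p' := fun y => by
  obtain ⟨n, m, e⟩ := hj.exists_eq y
  obtain ⟨f, rfl⟩ := hp m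
  obtain ⟨b, hb⟩ := (h.isUnit_toHat_pow n).exists_right_inv
  refine ⟨b • jF f, ?_⟩
  apply h.smul_pow_injective n
  rw [map_smul, w, ← mul_smul, hb, one_smul, e]

/-- Localization does not increase the projective dimension of a torsion-free module. -/
theorem IsLocalizationMap.modPDLT (n : ℕ) {M N : Type u} [AddCommGroup M] [Module R M]
    [AddCommGroup N] [Module h.Hat N] {j : M →ₛₗ[h.toHat] N} (hj : h.IsLocalizationMap j)
    (hpd : ModPDLT R M (n + 1)) : ModPDLT h.Hat N (n + 1) := by
  induction n generalizing M N with
  | zero =>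
    have := modPDLT_one_iff.1 hpd
    exact modPDLT_one_iff.2 hj.projective
  | succ n ih =>
    have hp := Finsupp.linearCombination_id_surjective R M
    have w := linearCombination_finsuppMap j
    rw [modPDLT_succ_iff_ker hp] at hpd
    rw [modPDLT_succ_iff_ker (hj.surjective_of_comm w hp)]
    exact ih ((isLocalizationMap_finsuppMap M).kerMap w hj) hpd

end Modules

end IsRegularNormal

namespace IsRegularNormal

variable {G : Type v} {R : Type u} [Ring R] {𝒜 : G → AddSubgroup R} {ε : G} {ħ : R}
  {h : IsRegularNormal 𝒜 ε ħ}

/-! ### Projectivity from the reduction and the localization -/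

section Key

variable {F K : Type u} [AddCommGroup F] [Module R F] [AddCommGroup K] [Module R K]

/-- If `K / ħK` is projective, an extension `0 → L → F → K → 0` with `K` torsion-free comes from
an extension by `ħL`: pull back a section of `F / ħF → K / ħK`. -/
theorem exists_submodule_ker_eq_smul [Module.Projective h.Bar (h.Red K)] (hK : h.TorsionFree K)
    (p : F →ₗ[R] K) (hp : Function.Surjective p) :
    ∃ F' : Submodule R F, (∀ k, ∃ f ∈ F', p f = k) ∧
      ∀ f ∈ F', p f = 0 → ∃ l, p l = 0 ∧ f = ħ • l := by
  obtain ⟨p', w⟩ := (h.isReduction_toRed (M := F)).exists_lift ((h.toRed K).comp p)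
  have hp' : Function.Surjective p' := fun y => by
    obtain ⟨k, rfl⟩ := h.isReduction_toRed.surjective y
    obtain ⟨f, rfl⟩ := hp k
    exact ⟨_, w f⟩
  obtain ⟨t, ht⟩ := Module.projective_lifting_property p' LinearMap.id hp'
  have ht' : ∀ y, p' (t y) = y := fun y => LinearMap.congr_fun ht y
  refine ⟨LinearMap.ker (h.toRed F - (t.comp (h.toRed K)).comp p), ?_, ?_⟩
  · intro k
    obtain ⟨f, rfl⟩ := hp k
    -- the defect of `f` is the class of some `g`, which can be moved into the kernel of `p`
    obtain ⟨g, hg⟩ := h.isReduction_toRed.surjective (h.toRed F f - t (h.toRed K (p f)))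
    have hg0 : h.toRed K (p g) = 0 := by
      have := w g
      rw [hg, map_sub, ht', w] at this
      rw [← LinearMap.comp_apply, ← this, LinearMap.comp_apply, sub_self]
    obtain ⟨k', hk'⟩ := h.isReduction_toRed.eq_smul _ hg0
    obtain ⟨g', rfl⟩ := hp k'
    have hpg : p (g - ħ • g') = 0 := by rw [map_sub, map_smul, hk', sub_self]
    refine ⟨f - (g - ħ • g'), ?_, by rw [map_sub, hpg, sub_zero]⟩
    rw [LinearMap.mem_ker, LinearMap.sub_apply, LinearMap.comp_apply, LinearMap.comp_apply,
      map_sub p, hpg, sub_zero, map_sub, map_sub, h.semilinear_bar_smul, hg]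
    abel
  · intro f hf hpf
    rw [LinearMap.mem_ker, LinearMap.sub_apply, LinearMap.comp_apply, LinearMap.comp_apply, hpf,
      map_zero, map_zero, sub_zero] at hf
    obtain ⟨l, rfl⟩ := h.isReduction_toRed.eq_smul _ hf
    rw [map_smul] at hpf
    exact ⟨l, hK _ hpf, rfl⟩

theorem exists_submodule_ker_eq_pow_smul [Module.Projective h.Bar (h.Red K)]
    (hK : h.TorsionFree K) (p : F →ₗ[R] K) (hp : Function.Surjective p) (n : ℕ) :
    ∃ F' : Submodule R F, (∀ k, ∃ f ∈ F', p f = k) ∧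
      ∀ f ∈ F', p f = 0 → ∃ l, p l = 0 ∧ f = ħ ^ n • l := by
  induction n with
  | zero => exact ⟨⊤, fun k => (hp k).imp fun f hf => ⟨trivial, hf⟩,
      fun f _ hf => ⟨f, hf, by rw [pow_zero, one_smul]⟩⟩
  | succ n ih =>
    obtain ⟨F', hF', hker⟩ := ih
    obtain ⟨F'', hF'', hker'⟩ := exists_submodule_ker_eq_smul hK (p ∘ₗ F'.subtype) fun k => by
      obtain ⟨f, hf, e⟩ := hF' k
      exact ⟨⟨f, hf⟩, e⟩
    refine ⟨F''.map F'.subtype, fun k => ?_, ?_⟩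
    · obtain ⟨f, hf, e⟩ := hF'' k
      exact ⟨f, ⟨f, hf, rfl⟩, e⟩
    · rintro _ ⟨f, hf, rfl⟩ hpf
      obtain ⟨g, hpg, rfl⟩ := hker' f hf hpf
      obtain ⟨l, hl, e⟩ := hker g g.2 hpg
      refine ⟨l, hl, ?_⟩
      rw [pow_succ', mul_smul, ← e]
      rfl

/-- A section of the localized presentation of a finitely generated module has a common
denominator. -/
theorem exists_common_denominator {F' N : Type u} [AddCommGroup F'] [Module h.Hat F']
    [AddCommGroup N] [Module h.Hat N] [Module.Finite R K] {jF : F →ₛₗ[h.toHat] F'}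
    (hjF : h.IsLocalizationMap jF) (s : K →ₛₗ[h.toHat] F') :
    ∃ n, ∀ k, ∃ f, h.toHat (ħ ^ n) • s k = jF f := by
  obtain ⟨t, ht⟩ := Module.Finite.fg_top (R := R) (M := K)
  choose d hd using fun k => hjF.exists_eq (s k)
  refine ⟨t.sup d, fun k => ?_⟩
  have hk : k ∈ Submodule.span R (t : Set K) := ht ▸ Submodule.mem_top
  induction hk using Submodule.span_induction with
  | mem k hk =>
    obtain ⟨m, hm⟩ := hd k
    obtain ⟨i, hi⟩ := Nat.exists_eq_add_of_le' (Finset.le_sup (f := d) hk)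
    exact ⟨_, hi ▸ smul_pow_add hm i⟩
  | zero => exact ⟨0, by rw [map_zero, map_zero, smul_zero]⟩
  | add x y _ _ hx hy =>
    obtain ⟨f, hf⟩ := hx
    obtain ⟨g, hg⟩ := hy
    exact ⟨f + g, by rw [map_add, map_add, smul_add, hf, hg]⟩
  | smul a x _ hx =>
    obtain ⟨f, hf⟩ := hx
    obtain ⟨b, hb⟩ := h.exists_left_pow (t.sup d) a
    refine ⟨b • f, ?_⟩
    rw [LinearMap.map_smulₛₗ, LinearMap.map_smulₛₗ, ← mul_smul, ← map_mul, ← hb, map_mul, mul_smul,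
      hf]

/-- A finitely generated module is projective as soon as it is torsion-free and its reduction and
its localization are projective. -/
theorem IsLocalizationMap.projective_of_reduction {N : Type u} [AddCommGroup N] [Module h.Hat N]
    [Module.Finite R K] {j : K →ₛₗ[h.toHat] N} (hj : h.IsLocalizationMap j)
    [Module.Projective h.Bar (h.Red K)] [Module.Projective h.Hat N] : Module.Projective R K := by
  let p : (K →₀ R) →ₗ[R] K := Finsupp.linearCombination R id
  have hp : Function.Surjective p := Finsupp.linearCombination_id_surjective R K
  let p' : (K →₀ h.Hat) →ₗ[h.Hat] N := Finsupp.linearCombination h.Hat j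
  let jF := finsuppMap h.toHat K
  have hjF : h.IsLocalizationMap jF := isLocalizationMap_finsuppMap K
  have w : ∀ f, p' (jF f) = j (p f) := linearCombination_finsuppMap j
  obtain ⟨s, hs⟩ := Module.projective_lifting_property p' LinearMap.id (hj.surjective_of_comm w hp)
  obtain ⟨n, hn⟩ := exists_common_denominator (N := N) hjF (s.comp j)
  obtain ⟨F', hF', hker⟩ := exists_submodule_ker_eq_pow_smul hj.torsionFree p hp n
  obtain ⟨φ, hφ⟩ := Module.projective_lifting_property (p ∘ₗ F'.subtype) p fun k => by
    obtain ⟨f, hf, e⟩ := hF' k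
    exact ⟨⟨f, hf⟩, e⟩
  have hφ' : ∀ f, p (φ f) = p f := fun f => LinearMap.congr_fun hφ f
  obtain ⟨φ', hφ''⟩ := hjF.exists_lift (jF.comp (F'.subtype ∘ₗ φ))
  -- applying `φ` removes the denominators of the section `s`
  have key : ∀ k, ∃ r, jF r = φ' (s (j k)) ∧ p r = k := by
    intro k
    obtain ⟨f, hf⟩ := hn k
    have hpf : p f = ħ ^ n • k := by
      apply hj.injective
      rw [← w, ← hf, map_smul, LinearMap.map_smulₛₗ]
      exact congrArg _ (LinearMap.congr_fun hs (j k))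
    obtain ⟨x, hx, hxk⟩ := hF' k
    obtain ⟨l, hl, e⟩ := hker (φ f - ħ ^ n • x)
      (sub_mem (φ f).2 (Submodule.smul_mem _ _ hx))
      (by rw [map_sub, hφ', hpf, map_smul, hxk, sub_self])
    refine ⟨x + l, ?_, by rw [map_add, hl, hxk, add_zero]⟩
    apply h.smul_pow_injective n
    rw [← LinearMap.map_smulₛₗ, smul_add, ← e, add_sub_cancel, ← map_smul φ']
    exact (hφ'' f).symm.trans (congrArg φ' hf.symm)
  choose r hr hpr using key
  refine Module.Projective.of_split (M := K →₀ R)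
    { toFun := r
      map_add' := fun x y => hjF.injective (by rw [hr, map_add jF, hr, hr]; simp only [map_add])
      map_smul' := fun a x => hjF.injective (by
        rw [RingHom.id_apply, hr, LinearMap.map_smulₛₗ jF, hr, LinearMap.map_smulₛₗ j, map_smul,
          map_smul]) }
    p (LinearMap.ext hpr)

end Key

end IsRegularNormal

/-! ### Change of rings for graded modules -/

namespace GrMod

variable {G : Type v} [AddCommGroup G] [DecidableEq G] {A B : Type u} [Ring A] [Ring B]
  {𝒜 : G → AddSubgroup A} [GradedRing 𝒜] {ℬ : G → AddSubgroup B} [GradedRing ℬ]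

/-- Restriction of scalars of a graded module along a degree-preserving ring homomorphism. -/
def restrictObj (φ : A →+* B) (hφ : ∀ i, ∀ a ∈ 𝒜 i, φ a ∈ ℬ i) (M : GrMod ℬ) : GrMod 𝒜 where
  carrier := M
  module := Module.compHom M φ
  deg := M.deg
  isInternal := M.isInternal
  smul_mem ha hm := M.smul_mem (hφ _ _ ha) hm

/-- The identity of `M`, as a semilinear map on the restriction of scalars. -/
def restrictMap (φ : A →+* B) (hφ : ∀ i, ∀ a ∈ 𝒜 i, φ a ∈ ℬ i) (M : GrMod ℬ) :
    restrictObj φ hφ M →ₛₗ[φ] M where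
  toFun x := x
  map_add' _ _ := rfl
  map_smul' _ _ := rfl

theorem restrictMap_bijective (φ : A →+* B) (hφ : ∀ i, ∀ a ∈ 𝒜 i, φ a ∈ ℬ i) (M : GrMod ℬ) :
    Function.Bijective (restrictMap φ hφ M) := Function.bijective_id

/-- A degree-preserving ring homomorphism commutes with taking homogeneous components. -/
theorem decompose_map (φ : A →+* B) (hφ : ∀ i, ∀ a ∈ 𝒜 i, φ a ∈ ℬ i) (a : A) (i : G) :
    (DirectSum.decompose ℬ (φ a) i : B) = φ (DirectSum.decompose 𝒜 a i) := by
  induction a using DirectSum.Decomposition.inductionOn 𝒜 with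
  | zero => simp
  | @homogeneous k a =>
    by_cases hk : k = i
    · subst hk
      rw [DirectSum.decompose_of_mem_same ℬ (hφ _ _ a.2), DirectSum.decompose_of_mem_same 𝒜 a.2]
    · rw [DirectSum.decompose_of_mem_ne ℬ (hφ _ _ a.2) hk,
        DirectSum.decompose_of_mem_ne 𝒜 a.2 hk, map_zero]
  | add a b ha hb => simp only [map_add, DirectSum.decompose_add, DirectSum.add_apply,
      AddSubgroup.coe_add, ha, hb]

end GrMod

namespace IsRegularNormal

open GrMod

/-! ### Modules killed by `ħ` -/

section Ungraded

variable {G : Type v} {R : Type u} [Ring R] {𝒜 : G → AddSubgroup R} {ε : G} {ħ : R}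
  {h : IsRegularNormal 𝒜 ε ħ}

theorem mem_span_iff (h : IsRegularNormal 𝒜 ε ħ) {a : R} :
    a ∈ Ideal.span {ħ} ↔ ∃ b, a = ħ * b := by
  rw [Ideal.mem_span_singleton']
  constructor
  · rintro ⟨c, rfl⟩
    exact h.exists_right c
  · rintro ⟨b, rfl⟩
    exact h.exists_left b

theorem isReduction_finsuppMap (ι : Type u) : h.IsReduction (finsuppMap h.toBar ι) where
  surjective := Finsupp.mapRange_surjective _ (map_zero _) h.toBar_surjective
  eq_smul f hf := by
    have hex : ∀ i, ∃ b, f i = ħ * b := fun i =>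
      h.mem_span_iff.1 (h.toBar_eq_zero.1 (DFunLike.congr_fun hf i))
    choose b hb using hex
    refine ⟨Finsupp.onFinset f.support b fun i hi => Finsupp.mem_support_iff.2 fun h0 => hi ?_,
      Finsupp.ext hb⟩
    exact h.regular.left (((hb i).symm.trans h0).trans (mul_zero ħ).symm)

/-- The automorphism `a ↦ ħ a ħ⁻¹` of `R`. -/
noncomputable def conj (h : IsRegularNormal 𝒜 ε ħ) : R →+* R where
  toFun a := (h.exists_left a).choose
  map_one' := h.regular.right (by
    change (h.exists_left 1).choose * ħ = 1 * ħ
    rw [(h.exists_left 1).choose_spec, mul_one, one_mul])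
  map_zero' := h.regular.right (by
    change (h.exists_left 0).choose * ħ = 0 * ħ
    rw [(h.exists_left 0).choose_spec, mul_zero, zero_mul])
  map_add' a b := h.regular.right (by
    change (h.exists_left (a + b)).choose * ħ =
      ((h.exists_left a).choose + (h.exists_left b).choose) * ħ
    rw [(h.exists_left (a + b)).choose_spec, add_mul, (h.exists_left a).choose_spec,
      (h.exists_left b).choose_spec, mul_add])
  map_mul' a b := h.regular.right (by
    change (h.exists_left (a * b)).choose * ħ =
      ((h.exists_left a).choose * (h.exists_left b).choose) * ħ
    rw [(h.exists_left (a * b)).choose_spec, mul_assoc, (h.exists_left b).choose_spec,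
      ← mul_assoc _ ħ b, (h.exists_left a).choose_spec, mul_assoc])

theorem conj_mul (h : IsRegularNormal 𝒜 ε ħ) (a : R) : h.conj a * ħ = ħ * a :=
  (h.exists_left a).choose_spec

theorem conj_eq (h : IsRegularNormal 𝒜 ε ħ) {a b : R} (e : b * ħ = ħ * a) : h.conj a = b :=
  h.regular.right ((h.conj_mul a).trans e.symm)

/-- Let `W` be an `R`-module killed by `ħ`, let `X` be the same module over `R / ħR` and `Y` its
twist by conjugation with `ħ`. If `F → W` is a free presentation over `R` with kernel `K`, and `Z`
is the kernel of the reduced presentation of `X`, then multiplication by `ħ` on `F` embeds `Y` into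
`K / ħK`, with cokernel `Z`. So if `W` and `X` have projective dimension at most `n + 1`, then that
of `Y` is at most `n`. -/
theorem modPDLT_twist {W X Y : Type u} [AddCommGroup W] [Module R W] [AddCommGroup X]
    [Module h.Bar X] [AddCommGroup Y] [Module h.Bar Y] (ρ : W →ₛₗ[h.toBar] X)
    (hρ : Function.Bijective ρ) (θ : W ≃+ Y)
    (hθ : ∀ a b, b * ħ = ħ * a → ∀ x, h.toBar b • θ x = θ (a • x)) (n : ℕ)
    (hW : ModPDLT R W (n + 2)) (hX : ModPDLT h.Bar X (n + 2)) : ModPDLT h.Bar Y (n + 1) := by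
  let p : (W →₀ R) →ₗ[R] W := Finsupp.linearCombination R id
  have hp : Function.Surjective p := Finsupp.linearCombination_id_surjective R W
  have hps : ∀ x, p (Finsupp.single x 1) = x := fun x => by simp [p]
  let p' : (W →₀ h.Bar) →ₗ[h.Bar] X := Finsupp.linearCombination h.Bar ρ
  have w : ∀ f, p' (finsuppMap h.toBar W f) = ρ (p f) := linearCombination_finsuppMap ρ
  have hp' : Function.Surjective p' := fun x => by
    obtain ⟨y, rfl⟩ := hρ.2 x
    obtain ⟨f, rfl⟩ := hp y
    exact ⟨_, w f⟩
  have hF : h.TorsionFree (W →₀ R) := h.torsionFree_of_free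
  have hK : h.TorsionFree (LinearMap.ker p) :=
    hF.of_injective (LinearMap.ker p).subtype Subtype.val_injective
  have hKred := (h.isReduction_toRed (M := LinearMap.ker p)).modPDLT n hK
    ((modPDLT_succ_iff_ker hp n).1 hW)
  have hZ := (modPDLT_succ_iff_ker hp' n).1 hX
  obtain ⟨g, hg⟩ := (h.isReduction_toRed (M := LinearMap.ker p)).exists_lift (kerMap w)
  have hpħ : ∀ f, ħ • f ∈ LinearMap.ker p := fun f => by
    apply hρ.1
    rw [map_smul, h.semilinear_bar_smul, map_zero]
  -- multiplication by `ħ`, as a map from the free module to `K / ħK`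
  let u : (W →₀ R) →+ h.Red (LinearMap.ker p) :=
    { toFun := fun f => h.toRed _ ⟨ħ • f, hpħ f⟩
      map_zero' := by
        rw [← map_zero (h.toRed (LinearMap.ker p))]
        exact congrArg _ (Subtype.ext (smul_zero ħ))
      map_add' := fun f f' => by
        rw [← map_add]
        exact congrArg _ (Subtype.ext (smul_add ħ f f')) }
  have hu0 : ∀ f, u f = 0 ↔ p f = 0 := by
    intro f
    constructor
    · intro h0
      obtain ⟨k, hk⟩ := h.isReduction_toRed.eq_smul _ h0
      have h1 : ħ • (f - (k : W →₀ R)) = 0 := by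
        rw [smul_sub, sub_eq_zero]
        exact congrArg Subtype.val hk
      rw [sub_eq_zero.1 (hF _ h1)]
      exact k.2
    · intro h0
      exact h.semilinear_bar_smul (h.toRed _) (⟨f, h0⟩ : LinearMap.ker p)
  have hu : ∀ f f', p f = p f' → u f = u f' := fun f f' e => by
    rw [← sub_eq_zero, ← map_sub, hu0, map_sub, e, sub_self]
  let j : Y →ₗ[h.Bar] h.Red (LinearMap.ker p) :=
    { toFun := fun y => u (Finsupp.single (θ.symm y) 1)
      map_add' := fun y y' => by
        rw [← map_add]
        apply hu
        rw [map_add p, hps, hps, hps, map_add]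
      map_smul' := fun b y => by
        obtain ⟨b, rfl⟩ := h.toBar_surjective b
        obtain ⟨x, rfl⟩ := θ.surjective y
        obtain ⟨a, e⟩ := h.exists_right b
        rw [RingHom.id_apply, hθ a b e, θ.symm_apply_apply, θ.symm_apply_apply]
        refine (hu _ (a • Finsupp.single x 1) (by rw [map_smul, hps, hps])).trans ?_
        refine Eq.trans ?_ ((h.toRed _).map_smulₛₗ b _)
        refine congrArg (h.toRed _) (Subtype.ext ?_)
        change ħ • a • Finsupp.single x (1 : R) = b • ħ • Finsupp.single x (1 : R)
        rw [← mul_smul, ← mul_smul, e] }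
  have hj : ∀ f, j (θ (p f)) = u f := fun f => by
    change u (Finsupp.single (θ.symm (θ (p f))) 1) = u f
    apply hu
    rw [hps, θ.symm_apply_apply]
  have hjinj : Function.Injective j := by
    rw [injective_iff_map_eq_zero]
    intro y hy
    obtain ⟨x, rfl⟩ := θ.surjective y
    obtain ⟨f, rfl⟩ := hp x
    rw [hj, hu0] at hy
    rw [hy, map_zero]
  have hgsurj : Function.Surjective g := by
    rintro ⟨z, hz⟩
    obtain ⟨f, rfl⟩ := isReduction_finsuppMap (h := h) W |>.surjective z
    rw [LinearMap.mem_ker, w] at hz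
    exact ⟨h.toRed _ ⟨f, hρ.1 (hz.trans (map_zero ρ).symm)⟩, hg _⟩
  have hexact : Function.Exact j g := by
    intro x
    obtain ⟨⟨k, hk⟩, rfl⟩ := h.isReduction_toRed.surjective x
    rw [hg]
    constructor
    · intro h0
      obtain ⟨f, rfl⟩ := isReduction_finsuppMap (h := h) W |>.eq_smul k (congrArg Subtype.val h0)
      exact ⟨θ (p f), hj f⟩
    · rintro ⟨y, hy⟩
      obtain ⟨x, rfl⟩ := θ.surjective y
      obtain ⟨f, rfl⟩ := hp x
      rw [hj] at hy
      rw [← hg, ← hy]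
      change g (h.toRed _ _) = 0
      rw [hg]
      exact Subtype.ext (h.semilinear_bar_smul (finsuppMap h.toBar W) f)
  exact (shortExact_shortComplexOfExact hexact hjinj hgsurj).hasProjectiveDimensionLT_X₁ (n + 1)
    hKred (hZ.mono (Nat.le_succ _))

/-! ### Torsion-free modules and localized submodules -/

theorem TorsionFree.of_projective {M : Type u} [AddCommGroup M] [Module R M]
    [Module.Projective R M] : h.TorsionFree M := by
  obtain ⟨s, hs⟩ := Module.projective_lifting_property
    (Finsupp.linearCombination R (id : M → M)) LinearMap.id
    (Finsupp.linearCombination_id_surjective R M)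
  have hF : h.TorsionFree (M →₀ R) := h.torsionFree_of_free
  exact hF.of_injective s (Function.LeftInverse.injective
    (g := Finsupp.linearCombination R (id : M → M)) fun m => LinearMap.congr_fun hs m)

theorem IsReduction.modPDLT_red {M N : Type u} [AddCommGroup M] [Module R M] [AddCommGroup N]
    [Module h.Bar N] {q : M →ₛₗ[h.toBar] N} (hq : h.IsReduction q) {n : ℕ}
    (hN : ModPDLT h.Bar N n) : ModPDLT h.Bar (h.Red M) n := by
  obtain ⟨g, hg⟩ := (h.isReduction_toRed (M := M)).exists_lift q
  refine hN.of_linearEquiv (LinearEquiv.ofBijective g ⟨?_, fun y => ?_⟩).symm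
  · rw [injective_iff_map_eq_zero]
    intro x hx
    obtain ⟨m, rfl⟩ := h.isReduction_toRed.surjective x
    rw [hg] at hx
    obtain ⟨m', rfl⟩ := hq.eq_smul m hx
    exact h.semilinear_bar_smul _ _
  · obtain ⟨m, rfl⟩ := hq.surjective y
    exact ⟨_, hg m⟩

/-- The localization of a submodule, inside a localization of the ambient module. -/
noncomputable def locSubmodule {M N : Type u} [AddCommGroup M] [Module R M] [AddCommGroup N] [Module h.Hat N]
    (j : M →ₛₗ[h.toHat] N) (K : Submodule R M) : Submodule h.Hat N where
  carrier := {y | ∃ n : ℕ, ∃ m ∈ K, h.toHat (ħ ^ n) • y = j m}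
  zero_mem' := ⟨0, 0, zero_mem _, by rw [smul_zero, map_zero]⟩
  add_mem' := by
    rintro x y ⟨n, m, hm, e⟩ ⟨n', m', hm', e'⟩
    have e2 := smul_pow_add e' n
    rw [add_comm] at e2
    exact ⟨n' + n, _, add_mem (K.smul_mem _ hm) (K.smul_mem _ hm'),
      by rw [smul_add, smul_pow_add e n', e2, ← map_add]⟩
  smul_mem' := by
    rintro x y ⟨n, m, hm, e⟩
    obtain ⟨k, a, rfl⟩ := h.exists_frac x
    obtain ⟨b, hb⟩ := h.exists_left_pow n a
    refine ⟨n + k, b • m, K.smul_mem _ hm, ?_⟩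
    rw [pow_add, map_mul, mul_smul, ← mul_smul (h.toHat (ħ ^ k)), toHat_mul_frac, ← mul_smul,
      ← map_mul, ← hb, map_mul, mul_smul, e, LinearMap.map_smulₛₗ]

/-- The map from a submodule to its localization. -/
noncomputable def locSubmoduleMap {M N : Type u} [AddCommGroup M] [Module R M] [AddCommGroup N]
    [Module h.Hat N] (j : M →ₛₗ[h.toHat] N) (K : Submodule R M) :
    K →ₛₗ[h.toHat] locSubmodule j K where
  toFun m := ⟨j m, 0, m, m.2, by rw [pow_zero, map_one, one_smul]⟩
  map_add' _ _ := Subtype.ext (map_add j _ _)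
  map_smul' _ _ := Subtype.ext (LinearMap.map_smulₛₗ j _ _)

theorem isLocalizationMap_locSubmoduleMap {M N : Type u} [AddCommGroup M] [Module R M]
    [AddCommGroup N] [Module h.Hat N] {j : M →ₛₗ[h.toHat] N} (hj : Function.Injective j)
    (K : Submodule R M) : h.IsLocalizationMap (locSubmoduleMap j K) where
  injective _ _ e := Subtype.ext (hj (congrArg Subtype.val e))
  exists_eq := by
    rintro ⟨y, n, m, hm, e⟩
    exact ⟨n, ⟨m, hm⟩, Subtype.ext e⟩

theorem nontrivial_bar (h : IsRegularNormal 𝒜 ε ħ) (hunit : ¬ IsUnit ħ) : Nontrivial h.Bar := by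
  refine ⟨0, 1, fun e => hunit ?_⟩
  have h1 : (1 : R) ∈ Ideal.span {ħ} := h.toBar_eq_zero.1 ((map_one _).trans e.symm)
  obtain ⟨a, ha⟩ := h.mem_span_iff.1 h1
  obtain ⟨b, hb⟩ := Ideal.mem_span_singleton'.1 h1
  exact isUnit_iff_exists_and_exists.2 ⟨⟨a, ha.symm⟩, ⟨b, hb⟩⟩

theorem toBar_mem (h : IsRegularNormal 𝒜 ε ħ) (i : G) (a : R) (ha : a ∈ 𝒜 i) :
    h.toBar a ∈ h.barDeg i := ⟨a, ha, rfl⟩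

end Ungraded

/-! ### Graded modules over `R`, `R / ħR` and `R[ħ⁻¹]` -/

variable {G : Type v} [AddCommGroup G] [DecidableEq G] {R : Type u} [Ring R]
  {𝒜 : G → AddSubgroup R} [GradedRing 𝒜] {ε : G} {ħ : R} (h : IsRegularNormal 𝒜 ε ħ)

theorem toHat_mem (i : G) (a : R) (ha : a ∈ 𝒜 i) : h.toHat a ∈ h.hatDeg i :=
  ⟨0, a, by rwa [zero_smul, zero_add], rfl⟩

theorem conj_mem (i : G) (a : R) (ha : a ∈ 𝒜 i) : h.conj a ∈ 𝒜 i :=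
  h.mem_of_mul_pow_eq (n := 1) ha (by rw [pow_one, conj_mul])

/-- The graded `R / ħR`-module `M / ħM`. -/
noncomputable def redObj (M : GrMod 𝒜) : GrMod h.barDeg :=
  imageObj M (h.toRed M).toAddMonoidHom h.isReduction_toRed.surjective
    (fun i x hx => by
      obtain ⟨m, rfl⟩ := h.isReduction_toRed.eq_smul x hx
      have := M.proj_smul (i - ε) h.mem m
      rw [add_sub_cancel] at this
      rw [this]
      exact h.semilinear_bar_smul (h.toRed M) _)
    (by
      rintro i _ ⟨a, ha, rfl⟩
      exact ⟨a, ha, fun x => ((h.toRed M).map_smulₛₗ a x).symm⟩)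

/-! ### The two bounds -/

/-- A bound for the graded global dimension of `R` bounds that of `R[ħ⁻¹]`: a graded
`R[ħ⁻¹]`-module is its own localization. -/
theorem modPDLT_hat (n : ℕ) (hR : ∀ M : GrMod 𝒜, ModPDLT R M (n + 1)) (Y : GrMod h.hatDeg) :
    ModPDLT h.Hat Y (n + 1) := by
  have hj : h.IsLocalizationMap (restrictMap h.toHat h.toHat_mem Y) :=
    { injective := (restrictMap_bijective _ _ _).1
      exists_eq := fun y => ⟨0, y, by rw [pow_zero, map_one, one_smul]; rfl⟩ }
  exact hj.modPDLT n (hR _)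

/-- If graded `R`-modules and graded `R / ħR`-modules have projective dimension at most `n + 1`, the
latter have projective dimension at most `n`, since every graded `R / ħR`-module is the twist of
another one. -/
theorem modPDLT_bar_of_succ (n : ℕ) (hR : ∀ M : GrMod 𝒜, ModPDLT R M (n + 2))
    (hB : ∀ X : GrMod h.barDeg, ModPDLT h.Bar X (n + 2)) (Y : GrMod h.barDeg) :
    ModPDLT h.Bar Y (n + 1) := by
  -- `W` is `Y` with the inverse twist, so that twisting it gives back `Y`
  let W : GrMod 𝒜 := restrictObj (h.toBar.comp h.conj)
    (fun i a ha => h.toBar_mem i _ (h.conj_mem i a ha)) Y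
  have hW : ∀ x : W, ħ • x = 0 := fun x => by
    change h.toBar (h.conj ħ) • (show Y from x) = 0
    rw [h.conj_eq rfl, h.toBar_self, zero_smul]
  refine modPDLT_twist (W := W) (X := h.Red W) (h.toRed W) ⟨?_, h.isReduction_toRed.surjective⟩
    (AddEquiv.refl Y) ?_ n (hR W) (hB (h.redObj W))
  · rw [injective_iff_map_eq_zero]
    intro x hx
    obtain ⟨m, rfl⟩ := h.isReduction_toRed.eq_smul x hx
    exact hW m
  · intro a b e x
    rw [← h.conj_eq e]
    rfl

/-- Not all graded `R`-modules are projective: `R / ħR` is not, as it is killed by `ħ`. -/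
theorem not_modPDLT_one (h : IsRegularNormal 𝒜 ε ħ) (hunit : ¬ IsUnit ħ) :
    ¬ ∀ M : GrMod 𝒜, ModPDLT R M 1 := by
  intro hR
  have := h.nontrivial_bar hunit
  let W : GrMod 𝒜 := restrictObj h.toBar h.toBar_mem (selfObj h.barDeg)
  have : Module.Projective R W := modPDLT_one_iff.1 (hR W)
  have hW : h.TorsionFree W := TorsionFree.of_projective
  have h0 : h.toBar ħ * 1 = (0 : h.Bar) := by rw [h.toBar_self, zero_mul]
  exact one_ne_zero (α := h.Bar) (hW (1 : h.Bar) h0)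

/-- Over a graded noetherian ring, the projective dimension of a finitely generated torsion-free
graded module is bounded by those of its reduction and its localization. -/
theorem modPDLT_of_red_of_loc (hnoeth : IsLeftGNoetherian 𝒜) (n : ℕ) (K : GrMod 𝒜)
    [Module.Finite R K] {N : Type u} [AddCommGroup N] [Module h.Hat N] {j : K →ₛₗ[h.toHat] N}
    (hj : h.IsLocalizationMap j) (hred : ModPDLT h.Bar (h.Red K) (n + 1))
    (hloc : ModPDLT h.Hat N (n + 1)) : ModPDLT R K (n + 1) := by
  induction n generalizing K N with
  | zero =>
    have := modPDLT_one_iff.1 hred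
    have := modPDLT_one_iff.1 hloc
    exact modPDLT_one_iff.2 hj.projective_of_reduction
  | succ n ih =>
    obtain ⟨F, p, hF, hFfin, hp, hker⟩ := exists_finite_free_cover hnoeth K
    let e := (Module.Free.chooseBasis R F).repr
    let jF : F →ₛₗ[h.toHat] (Module.Free.ChooseBasisIndex R F →₀ h.Hat) :=
      (finsuppMap h.toHat _).comp e.toLinearMap
    have hjF : h.IsLocalizationMap jF :=
      { injective := (isLocalizationMap_finsuppMap _).injective.comp e.injective
        exists_eq := fun y => by
          obtain ⟨k, m, hm⟩ := (isLocalizationMap_finsuppMap _).exists_eq y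
          refine ⟨k, e.symm m, hm.trans ?_⟩
          exact congrArg _ (e.apply_symm_apply m).symm }
    obtain ⟨p', w⟩ := hjF.exists_lift (j.comp (lin p))
    obtain ⟨p'', w'⟩ := (h.isReduction_toRed (M := F)).exists_lift ((h.toRed K).comp (lin p))
    have hp'' : Function.Surjective p'' := fun y => by
      obtain ⟨m, rfl⟩ := h.isReduction_toRed.surjective y
      obtain ⟨f, rfl⟩ := hp m
      exact ⟨_, w' f⟩
    have := (h.isReduction_toRed (M := F)).projective
    rw [modPDLT_succ_iff_ker hp'' n] at hred
    rw [modPDLT_succ_iff_ker (hj.surjective_of_comm w hp) n] at hloc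
    rw [modPDLT_succ_iff_ker hp n]
    exact ih (kerObj p) (hjF.kerMap w hj)
      ((IsReduction.kerMap w' h.isReduction_toRed h.isReduction_toRed hp
        hj.torsionFree).modPDLT_red hred) hloc

theorem isHomogeneous_locSubmodule {I : Ideal R} (hI : I.IsHomogeneous 𝒜) :
    Ideal.IsHomogeneous h.hatDeg (locSubmodule h.toHat.toSemilinearMap I : Ideal h.Hat) := by
  rintro i y ⟨n, a, ha, e⟩
  refine ⟨n, _, hI (n • ε + i) ha, ?_⟩
  have hn : h.toHat (ħ ^ n) ∈ h.hatDeg (n • ε) :=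
    h.toHat_mem _ _ (SetLike.pow_mem_graded n h.mem)
  have e' : h.toHat (ħ ^ n) * y = h.toHat a := e
  refine (DirectSum.coe_decompose_mul_add_of_left_mem h.hatDeg hn).symm.trans ?_
  rw [e']
  exact decompose_map h.toHat h.toHat_mem a _

/-- If the graded modules over `R / ħR` and `R[ħ⁻¹]` have projective dimension at most `n` and
`n + 1`, then those over `R` have projective dimension at most `n + 1`. It suffices to treat
`R / I`, that is, to bound the projective dimension of the torsion-free module `I` by `n`. -/
theorem modPDLT_of_bar_of_hat (hnoeth : IsLeftGNoetherian 𝒜) (n : ℕ)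
    (hB : ∀ X : GrMod h.barDeg, ModPDLT h.Bar X (n + 1))
    (hH : ∀ Y : GrMod h.hatDeg, ModPDLT h.Hat Y (n + 2)) (M : GrMod 𝒜) :
    ModPDLT R M (n + 2) := by
  refine modPDLT_of_cyclic (n + 1) (fun I hI => ?_) M
  let J : Ideal h.Hat := locSubmodule h.toHat.toSemilinearMap I
  have hJ : ModPDLT h.Hat (h.Hat ⧸ J) (n + 2) :=
    hH (cyclicObj J (h.isHomogeneous_locSubmodule hI))
  rw [modPDLT_succ_iff_ker J.mkQ_surjective n] at hJ
  rw [modPDLT_succ_iff_ker I.mkQ_surjective n]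
  replace hJ : ModPDLT h.Hat J (n + 1) :=
    hJ.of_linearEquiv (LinearEquiv.ofEq _ _ J.ker_mkQ)
  let K : GrMod 𝒜 := subObj (selfObj 𝒜) I fun i x hx =>
    (congrArg (fun z : R => z ∈ I) (selfObj_proj (𝒜 := 𝒜) i x)).mpr (hI i hx)
  have hfin : Module.Finite R I := Module.Finite.iff_fg.2 (hnoeth I hI)
  have : Module.Finite R K := hfin
  have hK : ModPDLT R I (n + 1) := h.modPDLT_of_red_of_loc hnoeth n K
    (isLocalizationMap_locSubmoduleMap (j := h.toHat.toSemilinearMap) h.toHat_injective I)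
    (hB (h.redObj K)) hJ
  exact hK.of_linearEquiv (LinearEquiv.ofEq _ _ I.ker_mkQ.symm)

end IsRegularNormal

/-! ### The global dimension -/

theorem WithBot.eq_of_forall_le_natCast_iff {a b : WithBot ℕ∞} (ha : 0 ≤ a) (hb : 0 ≤ b)
    (hab : ∀ n : ℕ, a ≤ n ↔ b ≤ n) : a = b := by
  have key : ∀ {a b : WithBot ℕ∞}, 0 ≤ b → (∀ n : ℕ, b ≤ n → a ≤ n) → a ≤ b := by
    intro a b hb hab
    induction b with
    | bot => simp at hb
    | coe b =>
      induction b with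
      | top => exact le_top
      | coe b => exact hab b le_rfl
  exact le_antisymm (key hb fun n => (hab n).2) (key ha fun n => (hab n).1)

theorem mainTheorem6 {G : Type v} [AddCommGroup G] [DecidableEq G] {R : Type u} [Ring R]
    (𝒜 : G → AddSubgroup R) [GradedRing 𝒜] (ε : G) (ħ : R) (h : IsRegularNormal 𝒜 ε ħ)
    (hunit : ¬ IsUnit ħ) (hnoeth : IsLeftGNoetherian 𝒜)
    (hfin : globalDimension (GrMod h.barDeg) < ⊤) :
    globalDimension (GrMod 𝒜) =
      max (globalDimension (GrMod h.barDeg) + 1) (globalDimension (GrMod h.hatDeg)) := by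
  have hBar := h.nontrivial_bar hunit
  have hR : Nontrivial R := h.toBar_surjective.nontrivial
  obtain ⟨d, hd⟩ : ∃ d : ℕ, globalDimension (GrMod h.barDeg) = d := by
    have h0 : 0 ≤ globalDimension (GrMod h.barDeg) := GrMod.globalDimension_nonneg
    generalize globalDimension (GrMod h.barDeg) = g at h0 hfin
    induction g with
    | bot => simp at h0
    | coe g =>
      induction g with
      | top => exact absurd hfin (lt_irrefl _)
      | coe g => exact ⟨g, rfl⟩
  have hB := (GrMod.globalDimension_le_iff d).1 hd.le
  have hd1 : globalDimension (GrMod h.barDeg) + 1 = (d + 1 : ℕ) := by rw [hd]; rfl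
  rw [hd1]
  refine WithBot.eq_of_forall_le_natCast_iff GrMod.globalDimension_nonneg
    (le_max_of_le_left (by exact_mod_cast Nat.zero_le (d + 1))) fun n => ?_
  rw [max_le_iff, GrMod.globalDimension_le_iff, GrMod.globalDimension_le_iff]
  constructor
  · intro hn
    refine ⟨?_, h.modPDLT_hat n hn⟩
    -- if the bound failed, the finite number `d` would not be the supremum over `R / ħR`
    by_contra hlt
    have hnd : n ≤ d := by
      by_contra hnd
      exact hlt (by exact_mod_cast Nat.succ_le_of_lt (not_le.1 hnd))
    have hRd : ∀ M : GrMod 𝒜, ModPDLT R M (d + 1) := fun M => (hn M).mono (by lia)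
    cases d with
    | zero => exact h.not_modPDLT_one hunit hRd
    | succ e =>
      have := (GrMod.globalDimension_le_iff e).2 (h.modPDLT_bar_of_succ e hRd hB)
      rw [hd] at this
      exact absurd (by exact_mod_cast this : e + 1 ≤ e) (by lia)
  · rintro ⟨hn, hH⟩
    have hdn : d + 1 ≤ n := by exact_mod_cast hn
    obtain ⟨m, rfl⟩ := Nat.exists_eq_add_of_le' (le_trans (Nat.le_add_left 1 d) hdn)
    exact h.modPDLT_of_bar_of_hat hnoeth m (fun X => (hB X).mono hdn) hH
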